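/- Formulae of infinitary commutative action logic $\mathbf{CommACT}_\omega$ are built from a countable set of variables and the constants $\mathbf 0,\mathbf 1$ by the binary connectives $\multimap,\cdot,\vee,\wedge$ and the unary connective $^*$. A sequent $\Gamma\vdash C$ consists of a finite multiset $\Gamma$ of formulae and a formula $C$. The derivable sequents form the least set that contains the axioms $$A\vdash A,\qquad \Gamma,\mathbf 0\vdash C,\qquad \vdash\mathbf 1$$ and is closed under the following rules (premises / conclusion): - $\Gamma\vdash C\;/\;\Gamma,\mathbf 1\vdash C$; - $\Pi\vdash A$ and $\Gamma,B\vdash C\;/\;\Gamma,\Pi,A\multimap B\vdash C$; and $A,\Pi\vdash B\;/\;\Pi\vdash A\multimap B$; - $\Gamma,A,B\vdash C\;/\;\Gamma,A\cdot B\vdash C$; and $\Pi\vdash A$, $\Delta\vdash B\;/\;\Pi,\Delta\vdash A\cdot B$; - $\Gamma,A\vdash C$ and $\Gamma,B\vdash C\;/\;\Gamma,A\vee B\vdash C$; and $\Pi\vdash A_i\;/\;\Pi\vdash A_1\vee A_2$ ($i=1,2$); - $\Gamma,A_i\vdash C\;/\;\Gamma,A_1\wedge A_2\vdash C$ ($i=1,2$);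 and $\Pi\vdash A$, $\Pi\vdash B\;/\;\Pi\vdash A\wedge B$; - the $\omega$-rule $(\Gamma,A^n\vdash C)_{n\ge 0}\;/\;\Gamma,A^*\vdash C$, where $A^n$ in the antecedent means $n$ copies of $A$; - $\Pi_1\vdash A,\dots,\Pi_n\vdash A\;/\;\Pi_1,\dots,\Pi_n\vdash A^*$ for each $n\ge 0$; - cut: $\Pi\vdash A$ and $\Gamma,A\vdash C\;/\;\Gamma,\Pi\vdash C$. For $n\ge 0$ define mappings $N_n,P_n$ on formulae by joint recursion: both are the identity on variables and constants and commute with $\cdot,\vee,\wedge$; $N_n(A\multimap B)=P_n(A)\multimap N_n(B)$ and $P_n(A\multimap B)=N_n(A)\multimap P_n(B)$; $P_n(A^*)=(P_n(A))^*$ and $N_n(A^*)=\mathbf 1\vee N_n(A)\vee (N_n(A))^2\vee\dots\vee (N_n(A))^n$, where here $F^k$ denotes the product $F\cdot\ldots\cdot F$ of $k$ factors. The $n$-th approximation of $A_1,\dots,A_m\vdash B$ is $N_n(A_1),\dots,N_n(A_m)\vdash P_n(B)$. **Theorem.** The derivability problem in $\mathbf{CommACT}_\omega$ belongs to the class $\Pi^0_1$: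 there is a decidable relation $R$ between sequents and natural numbers such that a sequent $s$ is derivable if and only if $R(s,n)$ holds for all $n$. Moreover: 1. a sequent is derivable if and only if its $n$-th approximation is derivable for every $n\ge 0$; 2. no $n$-th approximation of a sequent has a negative occurrence of $^*$ (an occurrence being negative in $\Gamma\vdash C$ if it is positive in a formula of $\Gamma$ or negative in $C$); 3. it is decidable, given a sequent and a number $n$, whether the $n$-th approximation of the sequent is derivable. -/

import Mathlib

namespace CommACT

/-- Formulae of infinitary commutative action logic. The countable set of variables is `ℕ`. -/
inductive Formula : Type
  | var (i : ℕ) : Formula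
  | zero : Formula
  | one : Formula
  | imp (A B : Formula) : Formula
  | mul (A B : Formula) : Formula
  | sup (A B : Formula) : Formula
  | inf (A B : Formula) : Formula
  | star (A : Formula) : Formula

namespace Formula

/-- Gödel numbering of formulae. -/
def toNat : Formula → ℕ
  | zero => 0
  | one => 1
  | var i => 6 * i + 2
  | star A => 6 * A.toNat + 3
  | imp A B => 6 * Nat.pair A.toNat B.toNat + 4
  | mul A B => 6 * Nat.pair A.toNat B.toNat + 5
  | sup A B => 6 * Nat.pair A.toNat B.toNat + 6
  | inf A B => 6 * Nat.pair A.toNat B.toNat + 7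

/-- The inverse of `toNat`. -/
def ofNat : ℕ → Formula
  | 0 => zero
  | 1 => one
  | k + 2 =>
    let m := k / 6
    have h0 : m < k + 2 := Nat.lt_of_le_of_lt (Nat.div_le_self k 6) (by omega)
    have h1 : m.unpair.1 < k + 2 := lt_of_le_of_lt m.unpair_left_le h0
    have h2 : m.unpair.2 < k + 2 := lt_of_le_of_lt m.unpair_right_le h0
    match k % 6 with
    | 0 => var m
    | 1 => star (ofNat m)
    | 2 => imp (ofNat m.unpair.1) (ofNat m.unpair.2)
    | 3 => mul (ofNat m.unpair.1) (ofNat m.unpair.2)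
    | 4 => sup (ofNat m.unpair.1) (ofNat m.unpair.2)
    | _ => inf (ofNat m.unpair.1) (ofNat m.unpair.2)
  decreasing_by all_goals first | exact h0 | exact h1 | exact h2

theorem ofNat_toNat (A : Formula) : ofNat A.toNat = A := by
  induction A with
  | zero => rw [toNat, ofNat]
  | one => rw [toNat, ofNat]
  | var i =>
    rw [toNat, ofNat]
    have h1 : 6 * i / 6 = i := by omega
    have h2 : 6 * i % 6 = 0 := by omega
    simp only [h1, h2]
  | star A ih =>
    rw [toNat, ofNat]
    have h1 : (6 * A.toNat + 1) / 6 = A.toNat := by omega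
    have h2 : (6 * A.toNat + 1) % 6 = 1 := by omega
    simp only [h1, h2, ih]
  | imp A B ihA ihB =>
    rw [toNat, ofNat]
    generalize hm : Nat.pair A.toNat B.toNat = m
    have h1 : (6 * m + 2) / 6 = m := by omega
    have h2 : (6 * m + 2) % 6 = 2 := by omega
    simp only [h1, h2]
    simp [← hm, ihA, ihB]
  | mul A B ihA ihB =>
    rw [toNat, ofNat]
    generalize hm : Nat.pair A.toNat B.toNat = m
    have h1 : (6 * m + 3) / 6 = m := by omega
    have h2 : (6 * m + 3) % 6 = 3 := by omega
    simp only [h1, h2]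
    simp [← hm, ihA, ihB]
  | sup A B ihA ihB =>
    rw [toNat, ofNat]
    generalize hm : Nat.pair A.toNat B.toNat = m
    have h1 : (6 * m + 4) / 6 = m := by omega
    have h2 : (6 * m + 4) % 6 = 4 := by omega
    simp only [h1, h2]
    simp [← hm, ihA, ihB]
  | inf A B ihA ihB =>
    rw [toNat, ofNat]
    generalize hm : Nat.pair A.toNat B.toNat = m
    have h1 : (6 * m + 5) / 6 = m := by omega
    have h2 : (6 * m + 5) % 6 = 5 := by omega
    simp only [h1, h2]
    simp [← hm, ihA, ihB]

theorem toNat_ofNat (k : ℕ) : (ofNat k).toNat = k := by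
  induction k using Nat.strong_induction_on with
  | _ k ih =>
    match k with
    | 0 => rw [ofNat, toNat]
    | 1 => rw [ofNat, toNat]
    | k + 2 =>
      have h0 : k / 6 < k + 2 := Nat.lt_of_le_of_lt (Nat.div_le_self k 6) (by omega)
      have i0 := ih _ h0
      have i1 := ih _ (lt_of_le_of_lt (k / 6).unpair_left_le h0)
      have i2 := ih _ (lt_of_le_of_lt (k / 6).unpair_right_le h0)
      have hk : k % 6 < 6 := Nat.mod_lt _ (by omega)
      have hd := Nat.div_add_mod k 6
      rw [ofNat]
      generalize hr : k % 6 = r at hk hd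
      interval_cases r <;> simp only [toNat, i0, i1, i2, Nat.pair_unpair] <;> omega

/-- Formulae are in effective bijection with the natural numbers; this fixes what it means for a
set of formulae to be decidable. -/
instance : Denumerable Formula :=
  Denumerable.mk' ⟨toNat, ofNat, ofNat_toNat, toNat_ofNat⟩

/-- The formula `A ^ n`: `A ^ 0 = 1`, `A ^ 1 = A`, `A ^ 2 = A · A`, and so on. -/
def pow (A : Formula) : ℕ → Formula
  | 0 => one
  | 1 => A
  | n + 2 => mul (pow A (n + 1)) A

/-- The formula `1 ∨ A ∨ A ^ 2 ∨ ⋯ ∨ A ^ n`. -/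
def powLe (A : Formula) : ℕ → Formula
  | 0 => one
  | n + 1 => sup (powLe A n) (pow A (n + 1))

/-- The two mappings by which the `n`-th approximation is defined, by joint recursion:
`approx n true` is `P_n` (for positive occurrences) and `approx n false` is `N_n` (for negative
occurrences, where `A*` becomes `1 ∨ A ∨ ⋯ ∨ A ^ n`). -/
def approx (n : ℕ) : Bool → Formula → Formula
  | _, var i => var i
  | _, zero => zero
  | _, one => one
  | b, imp A B => imp (approx n (!b) A) (approx n b B)
  | b, mul A B => mul (approx n b A) (approx n b B)
  | b, sup A B => sup (approx n b A) (approx n b B)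
  | b, inf A B => inf (approx n b A) (approx n b B)
  | true, star A => star (approx n true A)
  | false, star A => powLe (approx n false A) n

/-- `NoStar true A`: the star has no positive occurrence in `A`;
`NoStar false A`: the star has no negative occurrence in `A`. -/
def NoStar : Bool → Formula → Prop
  | _, var _ => True
  | _, zero => True
  | _, one => True
  | b, imp A B => NoStar (!b) A ∧ NoStar b B
  | b, mul A B => NoStar b A ∧ NoStar b B
  | b, sup A B => NoStar b A ∧ NoStar b B
  | b, inf A B => NoStar b A ∧ NoStar b B
  | true, star _ => False
  | false, star A => NoStar false A

end Formula

/-- A sequent `Γ ⊢ C`: a finite multiset `Γ` of formulae and a formula `C`. -/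
abbrev Sequent : Type := Multiset Formula × Formula

open Formula in
/-- Derivability of the sequent `Γ ⊢ C` in `CommACT_ω`: the least set of sequents that contains
the axioms and is closed under the rules, among them the ω-rule `starL` and `cut`. -/
inductive Derivable : Multiset Formula → Formula → Prop
  | id (A : Formula) : Derivable {A} A
  | zeroL (Γ : Multiset Formula) (C : Formula) : Derivable (Γ + {zero}) C
  | oneL (Γ : Multiset Formula) (C : Formula) : Derivable Γ C → Derivable (Γ + {one}) C
  | oneR : Derivable 0 one
  | impL (Γ Δ : Multiset Formula) (A B C : Formula) :
      Derivable Δ A → Derivable (Γ + {B}) C → Derivable (Γ + Δ + {imp A B}) C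
  | impR (Δ : Multiset Formula) (A B : Formula) :
      Derivable ({A} + Δ) B → Derivable Δ (imp A B)
  | mulL (Γ : Multiset Formula) (A B C : Formula) :
      Derivable (Γ + {A} + {B}) C → Derivable (Γ + {mul A B}) C
  | mulR (Δ Ξ : Multiset Formula) (A B : Formula) :
      Derivable Δ A → Derivable Ξ B → Derivable (Δ + Ξ) (mul A B)
  | supL (Γ : Multiset Formula) (A B C : Formula) :
      Derivable (Γ + {A}) C → Derivable (Γ + {B}) C → Derivable (Γ + {sup A B}) C
  | supR₁ (Δ : Multiset Formula) (A B : Formula) : Derivable Δ A → Derivable Δ (sup A B)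
  | supR₂ (Δ : Multiset Formula) (A B : Formula) : Derivable Δ B → Derivable Δ (sup A B)
  | infL₁ (Γ : Multiset Formula) (A B C : Formula) :
      Derivable (Γ + {A}) C → Derivable (Γ + {inf A B}) C
  | infL₂ (Γ : Multiset Formula) (A B C : Formula) :
      Derivable (Γ + {B}) C → Derivable (Γ + {inf A B}) C
  | infR (Δ : Multiset Formula) (A B : Formula) :
      Derivable Δ A → Derivable Δ B → Derivable Δ (inf A B)
  | starL (Γ : Multiset Formula) (A C : Formula) :
      (∀ n : ℕ, Derivable (Γ + Multiset.replicate n A) C) → Derivable (Γ + {star A}) C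
  | starR (n : ℕ) (Δ : Fin n → Multiset Formula) (A : Formula) :
      (∀ i, Derivable (Δ i) A) → Derivable (∑ i, Δ i) (star A)
  | cut (Γ Δ : Multiset Formula) (A C : Formula) :
      Derivable Δ A → Derivable (Γ + {A}) C → Derivable (Γ + Δ) C

namespace Sequent

/-- The sequent `s` is derivable in `CommACT_ω`. -/
def IsDerivable (s : Sequent) : Prop := Derivable s.1 s.2

/-- The `n`-th approximation `N_n(A₁), …, N_n(A_m) ⊢ P_n(B)` of `A₁, …, A_m ⊢ B`. -/
def approx (n : ℕ) (s : Sequent) : Sequent :=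
  (s.1.map (Formula.approx n false), Formula.approx n true s.2)

/-- The sequent has no negative occurrence of the star. Formulae of the antecedent occur
negatively in the sequent, so the positive occurrences of the star in them are excluded. -/
def NoNegStar (s : Sequent) : Prop :=
  (∀ A ∈ s.1, Formula.NoStar true A) ∧ Formula.NoStar false s.2

end Sequent

/-- The class `Π⁰₁`: `p a` is of the form `∀ n, R a n` with `R` decidable. -/
def IsPi01 {α : Type*} [Primcodable α] (p : α → Prop) : Prop :=
  ∃ R : α × ℕ → Prop, ComputablePred R ∧ ∀ a, p a ↔ ∀ n, R (a, n)

end CommACT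

/-! By induction on formulae, N_n(A) ⊢ N_m(A) ⊢ A ⊢ P_m(A) ⊢ P_n(A) for n ≤ m. Cuts with these
sequents show that a derivable sequent has derivable approximations, and that derivability of the
m-th approximation implies that of the n-th (`derivable_approx`, `derivable_approx_mono`).

The converse (`Sequent.isDerivable_of_approx`) is a compactness argument by well-founded induction
on sequents. If A* stands in the antecedent, then N_m(A*) follows from k copies of N_m(A) for every
m ≥ k, so every premise of the ω-rule inherits the hypothesis. Otherwise the last rule of a cut-free
proof of the n-th approximation is the image of a rule instance of the sequent itself. There are
finitely many such instances, so one of them serves infinitely many n, hence all n by monotonicity,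
and its premises fall under the induction hypothesis. The order must make all premises of the ω-rule
smaller, which the Dershowitz–Manna multiset order does.

Cut elimination is semantic: in the phase model made of cut-free derivability, every formula A
satisfies A ∈ ⟦A⟧ ⊆ {Γ | Γ ⊢ A without cut} (`interp_spec`), and all rules including cut are sound
(`Derivable.interpSum_subset`).

For decidability, an approximation has no negative star and cut-free rules preserve this, so the
ω-rule never occurs in its cut-free proofs. The other rules have finitely many instances per sequent
and lower a numerical weight, so proof search is primitive recursive. The relation R is derivability
of the n-th approximation. -/

namespace CommACT

open Formula hiding star
open Multiset (replicate nsmul_singleton replicate_succ singleton_add)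
open scoped Pointwise

/-! ### The cut-free calculus -/

/-- The possible lists of premises of a left rule, other than the ω-rule, with principal formula `F`
and conclusion `F, Δ, Ξ ⊢ C`. -/
def leftPremises : Formula → Multiset Formula → Multiset Formula → Formula → List (List Sequent)
  | var _, _, _, _ => []
  | zero, _, _, _ => [[]]
  | one, Δ, Ξ, C => [[(Δ + Ξ, C)]]
  | imp A B, Δ, Ξ, C => [[(Δ, A), ({B} + Ξ, C)]]
  | mul A B, Δ, Ξ, C => [[({A} + {B} + (Δ + Ξ), C)]]
  | sup A B, Δ, Ξ, C => [[({A} + (Δ + Ξ), C), ({B} + (Δ + Ξ), C)]]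
  | inf A B, Δ, Ξ, C => [[({A} + (Δ + Ξ), C)], [({B} + (Δ + Ξ), C)]]
  | .star _, _, _, _ => []

open scoped Classical in
/-- The possible lists of premises of a right rule with conclusion `Δ, Ξ ⊢ C`. The rules for the
star are `⊢ A*` and `Δ ⊢ A` and `Ξ ⊢ A*` / `Δ, Ξ ⊢ A*` with nonempty `Δ`. -/
noncomputable def rightPremises : Formula → Multiset Formula → Multiset Formula → List (List Sequent)
  | var _, _, _ => []
  | zero, _, _ => []
  | one, Δ, Ξ => if Δ + Ξ = 0 then [[]] else []
  | imp A B, Δ, Ξ => [[({A} + (Δ + Ξ), B)]]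
  | mul A B, Δ, Ξ => [[(Δ, A), (Ξ, B)]]
  | sup A B, Δ, Ξ => [[(Δ + Ξ, A)], [(Δ + Ξ, B)]]
  | inf A B, Δ, Ξ => [[(Δ + Ξ, A), (Δ + Ξ, B)]]
  | .star A, Δ, Ξ =>
    if Δ + Ξ = 0 then [[]] else if Δ = 0 then [] else [[(Δ, A), (Ξ, .star A)]]

/-- Derivability without cut, with the identity axiom restricted to variables. -/
inductive CutFree : Multiset Formula → Formula → Prop
  | var (i : ℕ) : CutFree {var i} (var i)
  | left (F : Formula) (Δ Ξ : Multiset Formula) (C : Formula) (ps : List Sequent) :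
      ps ∈ leftPremises F Δ Ξ C → (∀ p ∈ ps, CutFree p.1 p.2) → CutFree ({F} + (Δ + Ξ)) C
  | right (Δ Ξ : Multiset Formula) (C : Formula) (ps : List Sequent) :
      ps ∈ rightPremises C Δ Ξ → (∀ p ∈ ps, CutFree p.1 p.2) → CutFree (Δ + Ξ) C
  | starL (Γ : Multiset Formula) (A C : Formula) :
      (∀ n : ℕ, CutFree (Γ + replicate n A) C) → CutFree (Γ + {.star A}) C

theorem Derivable.starR_nil (A : Formula) : Derivable 0 (.star A) := by
  simpa using Derivable.starR 0 (fun _ => 0) A (fun i => i.elim0)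

/-- The ω-rule reduces Δ, A* ⊢ A* to the sequents Δ, A^n ⊢ A*, which are instances of the
(n+1)-premise right rule; a cut on A* then brings in Ξ. -/
theorem Derivable.starR_add {Δ Ξ : Multiset Formula} {A : Formula}
    (h₁ : Derivable Δ A) (h₂ : Derivable Ξ (.star A)) : Derivable (Δ + Ξ) (.star A) := by
  have h : Derivable (Δ + {.star A}) (.star A) := by
    refine .starL _ _ _ fun n => ?_
    have := Derivable.starR (n + 1) (Fin.cons Δ fun _ => {A}) A
      (Fin.cases h₁ fun _ => .id A)
    simpa [Fin.sum_univ_succ, nsmul_singleton] using this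
  exact .cut Δ Ξ _ _ h₂ h

theorem Derivable.of_leftPremises {F : Formula} {Δ Ξ : Multiset Formula} {C : Formula}
    {ps : List Sequent} (hps : ps ∈ leftPremises F Δ Ξ C)
    (h : ∀ p ∈ ps, Derivable p.1 p.2) : Derivable ({F} + (Δ + Ξ)) C := by
  rw [add_comm]
  cases F with
  | var i => simp [leftPremises] at hps
  | star A => simp [leftPremises] at hps
  | zero => exact .zeroL _ _
  | one =>
    simp only [leftPremises, List.mem_singleton] at hps
    subst hps
    exact .oneL _ _ (h _ (List.mem_singleton_self _))
  | imp A B =>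
    simp only [leftPremises, List.mem_singleton] at hps
    subst hps
    rw [add_comm Δ]
    refine .impL _ _ _ _ _ (h (Δ, A) (by simp)) ?_
    rw [add_comm]
    exact h ({B} + Ξ, C) (by simp)
  | mul A B =>
    simp only [leftPremises, List.mem_singleton] at hps
    subst hps
    refine .mulL _ _ _ _ ?_
    rw [add_assoc, add_comm]
    exact h _ (List.mem_singleton_self _)
  | sup A B =>
    simp only [leftPremises, List.mem_singleton] at hps
    subst hps
    refine .supL _ _ _ _ ?_ ?_ <;> rw [add_comm]
    · exact h ({A} + (Δ + Ξ), C) (by simp)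
    · exact h ({B} + (Δ + Ξ), C) (by simp)
  | inf A B =>
    simp only [leftPremises, List.mem_cons, List.not_mem_nil, or_false] at hps
    rcases hps with rfl | rfl
    · refine .infL₁ _ _ _ _ ?_
      rw [add_comm]
      exact h _ (List.mem_singleton_self _)
    · refine .infL₂ _ _ _ _ ?_
      rw [add_comm]
      exact h _ (List.mem_singleton_self _)

theorem Derivable.of_rightPremises {C : Formula} {Δ Ξ : Multiset Formula}
    {ps : List Sequent} (hps : ps ∈ rightPremises C Δ Ξ)
    (h : ∀ p ∈ ps, Derivable p.1 p.2) : Derivable (Δ + Ξ) C := by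
  cases C with
  | var i => simp [rightPremises] at hps
  | zero => simp [rightPremises] at hps
  | one =>
    by_cases h0 : Δ + Ξ = 0
    · rw [h0]; exact .oneR
    · simp [rightPremises, h0] at hps
  | imp A B =>
    simp only [rightPremises, List.mem_singleton] at hps
    subst hps
    exact .impR _ _ _ (h _ (List.mem_singleton_self _))
  | mul A B =>
    simp only [rightPremises, List.mem_singleton] at hps
    subst hps
    exact .mulR _ _ _ _ (h (Δ, A) (by simp)) (h (Ξ, B) (by simp))
  | sup A B =>
    simp only [rightPremises, List.mem_cons, List.not_mem_nil, or_false] at hps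
    rcases hps with rfl | rfl
    · exact .supR₁ _ _ _ (h _ (List.mem_singleton_self _))
    · exact .supR₂ _ _ _ (h _ (List.mem_singleton_self _))
  | inf A B =>
    simp only [rightPremises, List.mem_singleton] at hps
    subst hps
    exact .infR _ _ _ (h (Δ + Ξ, A) (by simp)) (h (Δ + Ξ, B) (by simp))
  | star A =>
    rw [rightPremises] at hps
    split_ifs at hps with h0 h1
    · rw [h0]; exact .starR_nil A
    · simp at hps
    · rw [List.mem_singleton] at hps
      subst hps
      exact .starR_add (h (Δ, A) (by simp)) (h (Ξ, .star A) (by simp))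

theorem CutFree.derivable {Γ : Multiset Formula} {C : Formula} (h : CutFree Γ C) :
    Derivable Γ C := by
  induction h with
  | var i => exact .id _
  | left F Δ Ξ C ps hps _ ih => exact .of_leftPremises hps ih
  | right Δ Ξ C ps hps _ ih => exact .of_rightPremises hps ih
  | starL Γ A C _ ih => exact .starL _ _ _ ih

/-! ### Phase semantics and cut elimination -/

/-- The closure of a set of multisets with respect to the sets
`{Γ | Γ, Δ ⊢ C is cut-free derivable}`. -/
def cl (X : Set (Multiset Formula)) : Set (Multiset Formula) :=
  {Γ | ∀ Δ C, (∀ Θ ∈ X, CutFree (Θ + Δ) C) → CutFree (Γ + Δ) C}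

theorem subset_cl (X : Set (Multiset Formula)) : X ⊆ cl X :=
  fun _ hΓ _ _ h => h _ hΓ

/-- The side context `Δ` in the definition of `cl` absorbs the elements of `Y`. This is what makes
left rules sound in an arbitrary context. -/
theorem cl_add_subset {X Y Z : Set (Multiset Formula)} (hZ : cl Z ⊆ Z) (h : X + Y ⊆ Z) :
    cl X + Y ⊆ Z := by
  rintro _ ⟨Γ, hΓ, Δ, hΔ, rfl⟩
  refine hZ fun Θ C hC => ?_
  rw [add_assoc]
  refine hΓ _ _ fun Λ hΛ => ?_
  rw [← add_assoc]
  exact hC _ (h (Set.add_mem_add hΛ hΔ))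

theorem cl_subset {X Z : Set (Multiset Formula)} (hZ : cl Z ⊆ Z) (h : X ⊆ Z) : cl X ⊆ Z := by
  simpa using cl_add_subset (Y := 0) hZ (by simpa using h)

theorem cl_cl_subset (X : Set (Multiset Formula)) : cl (cl X) ⊆ cl X :=
  fun _ hΓ _ _ h => hΓ _ _ fun _ hΘ => hΘ _ _ h

theorem cl_setOf_cutFree_subset (C : Formula) :
    cl {Γ | CutFree Γ C} ⊆ {Γ | CutFree Γ C} := by
  intro Γ hΓ
  simpa using hΓ 0 C (by simp)

/-- The phase semantics of formulae in the closed sets. -/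
def interp : Formula → Set (Multiset Formula)
  | var i => {Γ | CutFree Γ (var i)}
  | zero => cl ∅
  | one => cl 0
  | imp A B => {Γ | ∀ Δ ∈ interp A, Γ + Δ ∈ interp B}
  | mul A B => cl (interp A + interp B)
  | sup A B => cl (interp A ∪ interp B)
  | inf A B => interp A ∩ interp B
  | .star A => cl (⋃ n : ℕ, n • interp A)

theorem cl_interp_subset (A : Formula) : cl (interp A) ⊆ interp A := by
  induction A with
  | var i => exact cl_setOf_cutFree_subset _
  | zero => exact cl_cl_subset _
  | one => exact cl_cl_subset _
  | mul A B => exact cl_cl_subset _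
  | sup A B => exact cl_cl_subset _
  | star A => exact cl_cl_subset _
  | imp A B _ ihB =>
    intro Γ hΓ Δ hΔ
    refine cl_add_subset (X := interp (imp A B)) (Y := interp A) ihB ?_ (Set.add_mem_add hΓ hΔ)
    rintro _ ⟨Γ, hΓ, Δ, hΔ, rfl⟩
    exact hΓ _ hΔ
  | inf A B ihA ihB =>
    intro Γ hΓ
    exact ⟨ihA fun Δ C h => hΓ _ _ fun Θ hΘ => h _ hΘ.1,
      ihB fun Δ C h => hΓ _ _ fun Θ hΘ => h _ hΘ.2⟩

/-- The binary star rule demands a nonempty first part. An empty summand adds nothing to the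
antecedent and is skipped. -/
theorem CutFree.of_mem_nsmul {A : Formula} {X : Set (Multiset Formula)}
    (hX : X ⊆ {Γ | CutFree Γ A}) (n : ℕ) : n • X ⊆ {Γ | CutFree Γ (.star A)} := by
  induction n with
  | zero =>
    rw [zero_nsmul]
    rintro _ rfl
    exact .right 0 0 (.star A) [] (by simp [rightPremises]) (by simp)
  | succ n ih =>
    rw [succ_nsmul']
    rintro _ ⟨Γ, hΓ, Δ, hΔ, rfl⟩
    by_cases h0 : Γ = 0
    · subst h0
      simpa using ih hΔ
    · exact .right Γ Δ (.star A) [(Γ, A), (Δ, .star A)] (by simp [rightPremises, h0])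
        (by simpa using ⟨hX hΓ, ih hΔ⟩)

theorem replicate_mem_nsmul {A : Formula} {X : Set (Multiset Formula)} (h : {A} ∈ X) (n : ℕ) :
    replicate n A ∈ n • X := by
  induction n with
  | zero => simp
  | succ n ih =>
    rw [succ_nsmul', replicate_succ, ← singleton_add]
    exact Set.add_mem_add h ih

/-- Okada's lemma. Left rules give the first half and right rules the second. Both are proved
together because implication exchanges them: its first half uses the second half for `A`, and its
second half uses the first half for `A`. -/
theorem interp_spec (A : Formula) : {A} ∈ interp A ∧ interp A ⊆ {Γ | CutFree Γ A} := by
  induction A with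
  | var i => exact ⟨.var i, subset_rfl⟩
  | zero =>
    refine ⟨fun Δ C _ => ?_, cl_subset (cl_setOf_cutFree_subset _) (Set.empty_subset _)⟩
    simpa using CutFree.left zero Δ 0 C [] (by simp [leftPremises]) (by simp)
  | one =>
    refine ⟨fun Δ C h => ?_, cl_subset (cl_setOf_cutFree_subset _) ?_⟩
    · simpa using CutFree.left one Δ 0 C [(Δ, C)] (by simp [leftPremises])
        (by simpa using h 0 rfl)
    · rintro _ rfl
      exact .right 0 0 one [] (by simp [rightPremises]) (by simp)
  | imp A B ihA ihB =>
    constructor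
    · intro Δ hΔ
      refine cl_interp_subset B fun Ξ C h => ?_
      rw [add_assoc]
      exact .left (imp A B) Δ Ξ C [(Δ, A), ({B} + Ξ, C)] (by simp [leftPremises])
        (by simpa using ⟨ihA.2 hΔ, h _ ihB.1⟩)
    · intro Γ hΓ
      have := ihB.2 (hΓ _ ihA.1)
      simpa using CutFree.right Γ 0 (imp A B) [({A} + Γ, B)] (by simp [rightPremises])
        (by simpa [add_comm] using this)
  | mul A B ihA ihB =>
    refine ⟨fun Δ C h => ?_, cl_subset (cl_setOf_cutFree_subset _) ?_⟩
    · simpa using CutFree.left (mul A B) Δ 0 C [({A} + {B} + Δ, C)] (by simp [leftPremises])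
        (by simpa using h _ (Set.add_mem_add ihA.1 ihB.1))
    · rintro _ ⟨Γ, hΓ, Δ, hΔ, rfl⟩
      exact .right Γ Δ (mul A B) [(Γ, A), (Δ, B)] (by simp [rightPremises])
        (by simpa using ⟨ihA.2 hΓ, ihB.2 hΔ⟩)
  | sup A B ihA ihB =>
    refine ⟨fun Δ C h => ?_, cl_subset (cl_setOf_cutFree_subset _) ?_⟩
    · simpa using CutFree.left (sup A B) Δ 0 C [({A} + Δ, C), ({B} + Δ, C)]
        (by simp [leftPremises]) (by simpa using ⟨h _ (.inl ihA.1), h _ (.inr ihB.1)⟩)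
    · rintro Γ (hΓ | hΓ)
      · simpa using CutFree.right Γ 0 (sup A B) [(Γ, A)] (by simp [rightPremises])
          (by simpa using ihA.2 hΓ)
      · simpa using CutFree.right Γ 0 (sup A B) [(Γ, B)] (by simp [rightPremises])
          (by simpa using ihB.2 hΓ)
  | inf A B ihA ihB =>
    refine ⟨⟨cl_interp_subset A fun Δ C h => ?_, cl_interp_subset B fun Δ C h => ?_⟩,
      fun Γ hΓ => ?_⟩
    · simpa using CutFree.left (inf A B) Δ 0 C [({A} + Δ, C)] (by simp [leftPremises])
        (by simpa using h _ ihA.1)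
    · simpa using CutFree.left (inf A B) Δ 0 C [({B} + Δ, C)] (by simp [leftPremises])
        (by simpa using h _ ihB.1)
    · simpa using CutFree.right Γ 0 (inf A B) [(Γ, A), (Γ, B)] (by simp [rightPremises])
        (by simpa using ⟨ihA.2 hΓ.1, ihB.2 hΓ.2⟩)
  | star A ihA =>
    refine ⟨fun Δ C h => ?_, cl_subset (cl_setOf_cutFree_subset _) ?_⟩
    · rw [add_comm]
      refine .starL _ _ _ fun n => ?_
      rw [add_comm]
      exact h _ (Set.mem_iUnion.2 ⟨n, replicate_mem_nsmul ihA.1 n⟩)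
    · exact Set.iUnion_subset fun n => CutFree.of_mem_nsmul ihA.2 n

/-- The interpretation of the antecedent of a sequent. -/
def interpSum (Γ : Multiset Formula) : Set (Multiset Formula) := (Γ.map interp).sum

@[simp] theorem interpSum_zero : interpSum 0 = 0 := rfl

@[simp] theorem interpSum_add (Γ Δ : Multiset Formula) :
    interpSum (Γ + Δ) = interpSum Γ + interpSum Δ := by simp [interpSum]

@[simp] theorem interpSum_singleton (A : Formula) : interpSum {A} = interp A := by
  simp [interpSum]

@[simp] theorem interpSum_replicate (n : ℕ) (A : Formula) :
    interpSum (replicate n A) = n • interp A := by simp [interpSum]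

theorem mem_interpSum (Γ : Multiset Formula) : Γ ∈ interpSum Γ := by
  induction Γ using Multiset.induction with
  | empty => exact rfl
  | cons A Γ ih =>
    rw [← singleton_add, interpSum_add, interpSum_singleton]
    exact Set.add_mem_add (interp_spec A).1 ih

theorem interpSum_sum_subset {A : Formula} (n : ℕ) (Δ : Fin n → Multiset Formula)
    (h : ∀ i, interpSum (Δ i) ⊆ interp A) : interpSum (∑ i, Δ i) ⊆ n • interp A := by
  induction n with
  | zero => simp
  | succ n ih =>
    rw [Fin.sum_univ_succ, interpSum_add, succ_nsmul']
    exact Set.add_subset_add (h 0) (ih _ fun i => h _)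

theorem add_cl_subset {X Y Z : Set (Multiset Formula)} (hZ : cl Z ⊆ Z) (h : Y + X ⊆ Z) :
    Y + cl X ⊆ Z := by
  rw [add_comm] at h ⊢
  exact cl_add_subset hZ h

/-- Soundness of the calculus with cut. Since `interp C` is closed, a left rule for a connective
interpreted by a closure need only be checked on the generators; for the star these form a union
over `n`, which matches the premises of the ω-rule. -/
theorem Derivable.interpSum_subset {Γ : Multiset Formula} {C : Formula} (h : Derivable Γ C) :
    interpSum Γ ⊆ interp C := by
  induction h with
  | id A => simp
  | zeroL Γ C =>
    simp only [interpSum_add, interpSum_singleton]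
    exact add_cl_subset (cl_interp_subset C) (by simp)
  | oneL Γ C _ ih =>
    simp only [interpSum_add, interpSum_singleton]
    exact add_cl_subset (cl_interp_subset C) (by simpa using ih)
  | oneR => exact subset_cl _
  | impL Γ Δ A B C _ _ ihA ihC =>
    simp only [interpSum_add, interpSum_singleton] at *
    refine subset_trans ?_ ihC
    rw [add_assoc]
    refine Set.add_subset_add subset_rfl ?_
    rintro _ ⟨Θ, hΘ, Λ, hΛ, rfl⟩
    show Θ + Λ ∈ _
    rw [add_comm]
    exact hΛ _ (ihA hΘ)
  | impR Δ A B _ ih =>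
    simp only [interpSum_add, interpSum_singleton] at ih
    intro Γ hΓ Θ hΘ
    rw [add_comm]
    exact ih (Set.add_mem_add hΘ hΓ)
  | mulL Γ A B C _ ih =>
    simp only [interpSum_add, interpSum_singleton] at *
    refine add_cl_subset (cl_interp_subset C) ?_
    rwa [← add_assoc]
  | mulR Δ Ξ A B _ _ ihA ihB =>
    rw [interpSum_add]
    exact (Set.add_subset_add ihA ihB).trans (subset_cl _)
  | supL Γ A B C _ _ ihA ihB =>
    simp only [interpSum_add, interpSum_singleton] at *
    refine add_cl_subset (cl_interp_subset C) ?_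
    rw [Set.add_union]
    exact Set.union_subset ihA ihB
  | supR₁ Δ A B _ ih => exact ih.trans (Set.subset_union_left.trans (subset_cl _))
  | supR₂ Δ A B _ ih => exact ih.trans (Set.subset_union_right.trans (subset_cl _))
  | infL₁ Γ A B C _ ih =>
    simp only [interpSum_add, interpSum_singleton] at *
    exact (Set.add_subset_add subset_rfl Set.inter_subset_left).trans ih
  | infL₂ Γ A B C _ ih =>
    simp only [interpSum_add, interpSum_singleton] at *
    exact (Set.add_subset_add subset_rfl Set.inter_subset_right).trans ih
  | infR Δ A B _ _ ihA ihB => exact Set.subset_inter ihA ihB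
  | starL Γ A C _ ih =>
    simp only [interpSum_add, interpSum_singleton, interpSum_replicate] at *
    refine add_cl_subset (cl_interp_subset C) ?_
    rw [Set.add_iUnion]
    exact Set.iUnion_subset ih
  | starR n Δ A _ ih =>
    exact (interpSum_sum_subset n Δ ih).trans
      ((Set.subset_iUnion (fun n : ℕ => n • interp A) n).trans (subset_cl _))
  | cut Γ Δ A C _ _ ihA ihC =>
    simp only [interpSum_add, interpSum_singleton] at *
    exact (Set.add_subset_add subset_rfl ihA).trans ihC

/-- Cut elimination. -/
theorem Derivable.cutFree {Γ : Multiset Formula} {C : Formula} (h : Derivable Γ C) :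
    CutFree Γ C :=
  -- Γ belongs to its own interpretation, hence to that of C by soundness, and membership there is
  -- cut-free derivability.
  (interp_spec C).2 (h.interpSum_subset (mem_interpSum Γ))

/-! ### Comparison of formulae with their approximations -/

namespace Derivable

theorem trans {Γ : Multiset Formula} {A B : Formula} (h₁ : Derivable Γ A)
    (h₂ : Derivable {A} B) : Derivable Γ B := by
  simpa using cut 0 Γ A B h₁ (by simpa using h₂)

theorem imp_mono {A A' B B' : Formula} (hA : Derivable {A'} A) (hB : Derivable {B} B') :
    Derivable {imp A B} (imp A' B') := by
  refine impR _ _ _ ?_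
  simpa using impL 0 {A'} A B B' hA (by simpa using hB)

theorem mul_mono {A A' B B' : Formula} (hA : Derivable {A} A') (hB : Derivable {B} B') :
    Derivable {mul A B} (mul A' B') := by
  simpa using mulL 0 A B _ (by simpa using mulR _ _ _ _ hA hB)

theorem sup_elim {A B C : Formula} (hA : Derivable {A} C) (hB : Derivable {B} C) :
    Derivable {sup A B} C := by
  simpa using supL 0 A B _ (by simpa using hA) (by simpa using hB)

theorem sup_mono {A A' B B' : Formula} (hA : Derivable {A} A') (hB : Derivable {B} B') :
    Derivable {sup A B} (sup A' B') :=
  sup_elim (supR₁ _ _ _ hA) (supR₂ _ _ _ hB)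

theorem inf_mono {A A' B B' : Formula} (hA : Derivable {A} A') (hB : Derivable {B} B') :
    Derivable {inf A B} (inf A' B') := by
  refine infR _ _ _ ?_ ?_
  · simpa using infL₁ 0 A B _ (by simpa using hA)
  · simpa using infL₂ 0 A B _ (by simpa using hB)

theorem starR_replicate {A B : Formula} (h : Derivable {A} B) (n : ℕ) :
    Derivable (replicate n A) (.star B) := by
  simpa [nsmul_singleton] using starR n (fun _ => {A}) B fun _ => h

theorem star_mono {A B : Formula} (h : Derivable {A} B) :
    Derivable {.star A} (.star B) := by
  simpa using starL 0 A _ fun n => by simpa using starR_replicate h n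

theorem one_elim {C : Formula} (h : Derivable 0 C) : Derivable {one} C := by
  simpa using oneL 0 C h

theorem pow_elim {A C : Formula} (k : ℕ) (h : Derivable (replicate k A) C) :
    Derivable {pow A k} C := by
  -- Unfolding the product leaves one factor behind in the context, so the induction needs an
  -- arbitrary context.
  suffices ∀ Γ, Derivable (Γ + replicate k A) C → Derivable (Γ + {pow A k}) C by
    simpa using this 0 (by simpa using h)
  clear h
  induction k with
  | zero => exact fun Γ h => oneL _ _ (by simpa using h)
  | succ k ih =>
    cases k with
    | zero => simp [pow]
    | succ k =>
      intro Γ h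
      refine mulL _ _ _ _ ?_
      rw [add_right_comm]
      refine ih _ ?_
      rw [replicate_succ, ← singleton_add, ← add_assoc] at h
      exact h

theorem pow_intro {A B : Formula} (h : Derivable {A} B) (k : ℕ) :
    Derivable (replicate k A) (pow B k) := by
  induction k with
  | zero => exact oneR
  | succ k ih =>
    cases k with
    | zero => simpa [pow] using h
    | succ k =>
      rw [replicate_succ, ← singleton_add, add_comm]
      exact mulR _ _ _ _ ih h

theorem powLe_intro {Γ : Multiset Formula} {A : Formula} {k n : ℕ} (hk : k ≤ n)
    (h : Derivable Γ (pow A k)) : Derivable Γ (powLe A n) := by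
  induction n with
  | zero =>
    obtain rfl : k = 0 := by omega
    exact h
  | succ n ih =>
    rcases Nat.lt_or_ge n k with hk' | hk'
    · obtain rfl : k = n + 1 := by omega
      exact supR₂ _ _ _ h
    · exact supR₁ _ _ _ (ih hk')

theorem powLe_elim {A C : Formula} {n : ℕ} (h : ∀ k ≤ n, Derivable (replicate k A) C) :
    Derivable {powLe A n} C := by
  induction n with
  | zero => exact one_elim (h 0 le_rfl)
  | succ n ih =>
    exact sup_elim (ih fun k hk => h k (by omega)) (pow_elim _ (h _ le_rfl))

/-- The formulae of the antecedent are exchanged one at a time by cuts; the context `Θ` holds those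
already treated. -/
theorem map_left {f g : Formula → Formula} (h : ∀ A, Derivable {f A} (g A))
    {Γ : Multiset Formula} {C : Formula} (hC : Derivable (Γ.map g) C) :
    Derivable (Γ.map f) C := by
  suffices ∀ Θ, Derivable (Θ + Γ.map g) C → Derivable (Θ + Γ.map f) C by
    simpa using this 0 (by simpa using hC)
  clear hC
  induction Γ using Multiset.induction with
  | empty => simp
  | cons A Γ ih =>
    intro Θ hΘ
    rw [Multiset.map_cons, ← singleton_add, ← add_assoc] at hΘ ⊢
    have := ih _ hΘ
    rw [add_right_comm] at this ⊢
    exact cut _ _ _ _ (h A) this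

end Derivable

open Derivable in
theorem derivable_approx (n : ℕ) (A : Formula) :
    Derivable {A.approx n false} A ∧ Derivable {A} (A.approx n true) := by
  induction A with
  | var i => exact ⟨.id _, .id _⟩
  | zero => exact ⟨.id _, .id _⟩
  | one => exact ⟨.id _, .id _⟩
  | imp A B ihA ihB => exact ⟨imp_mono ihA.2 ihB.1, imp_mono ihA.1 ihB.2⟩
  | mul A B ihA ihB => exact ⟨mul_mono ihA.1 ihB.1, mul_mono ihA.2 ihB.2⟩
  | sup A B ihA ihB => exact ⟨sup_mono ihA.1 ihB.1, sup_mono ihA.2 ihB.2⟩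
  | inf A B ihA ihB => exact ⟨inf_mono ihA.1 ihB.1, inf_mono ihA.2 ihB.2⟩
  | star A ih => exact ⟨powLe_elim fun k _ => starR_replicate ih.1 k, star_mono ih.2⟩

open Derivable in
-- A larger index gives a longer disjunction, hence a weaker N; polarity swaps at implication, so
-- the two halves are proved jointly.
theorem derivable_approx_mono {n m : ℕ} (h : n ≤ m) (A : Formula) :
    Derivable {A.approx n false} (A.approx m false) ∧
      Derivable {A.approx m true} (A.approx n true) := by
  induction A with
  | var i => exact ⟨.id _, .id _⟩
  | zero => exact ⟨.id _, .id _⟩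
  | one => exact ⟨.id _, .id _⟩
  | imp A B ihA ihB => exact ⟨imp_mono ihA.2 ihB.1, imp_mono ihA.1 ihB.2⟩
  | mul A B ihA ihB => exact ⟨mul_mono ihA.1 ihB.1, mul_mono ihA.2 ihB.2⟩
  | sup A B ihA ihB => exact ⟨sup_mono ihA.1 ihB.1, sup_mono ihA.2 ihB.2⟩
  | inf A B ihA ihB => exact ⟨inf_mono ihA.1 ihB.1, inf_mono ihA.2 ihB.2⟩
  | star A ih =>
    exact ⟨powLe_elim fun k hk => powLe_intro (hk.trans h) (pow_intro ih.1 k), star_mono ih.2⟩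

theorem Sequent.IsDerivable.approx {s : Sequent} (h : s.IsDerivable) (n : ℕ) :
    (s.approx n).IsDerivable :=
  .trans (.map_left (g := id) (fun A => (derivable_approx n A).1) (by simpa [IsDerivable] using h))
    (derivable_approx n _).2

theorem Sequent.IsDerivable.approx_of_le {s : Sequent} {n m : ℕ}
    (h : (s.approx m).IsDerivable) (hnm : n ≤ m) : (s.approx n).IsDerivable :=
  .trans (.map_left (fun A => (derivable_approx_mono hnm A).1) h)
    (derivable_approx_mono hnm _).2

/-! ### Approximations have no negative star -/

theorem Formula.noStar_pow {b : Bool} {A : Formula} (h : NoStar b A) (n : ℕ) :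
    NoStar b (pow A n) := by
  induction n with
  | zero => trivial
  | succ n ih =>
    cases n with
    | zero => exact h
    | succ n => exact ⟨ih, h⟩

theorem Formula.noStar_powLe {b : Bool} {A : Formula} (h : NoStar b A) (n : ℕ) :
    NoStar b (powLe A n) := by
  induction n with
  | zero => trivial
  | succ n ih => exact ⟨ih, noStar_pow h _⟩

theorem Formula.noStar_approx (n : ℕ) (b : Bool) (A : Formula) :
    NoStar (!b) (A.approx n b) := by
  induction A generalizing b with
  | var i => trivial
  | zero => trivial
  | one => trivial
  | imp A B ihA ihB => exact ⟨ihA _, ihB _⟩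
  | mul A B ihA ihB => exact ⟨ihA _, ihB _⟩
  | sup A B ihA ihB => exact ⟨ihA _, ihB _⟩
  | inf A B ihA ihB => exact ⟨ihA _, ihB _⟩
  | star A ih =>
    cases b with
    | true => exact ih true
    | false => exact noStar_powLe (ih false) n

theorem Sequent.noNegStar_approx (s : Sequent) (n : ℕ) : (s.approx n).NoNegStar := by
  refine ⟨fun A hA => ?_, noStar_approx n true s.2⟩
  obtain ⟨B, -, rfl⟩ := Multiset.mem_map.1 hA
  exact noStar_approx n false B

/-! ### Rule instances and a well-founded order that decreases along them -/

/-- `IsRule s ps`: the sequent `s` follows from the sequents `ps` by a cut-free rule other than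
the ω-rule. -/
def IsRule (s : Sequent) (ps : List Sequent) : Prop :=
  (∃ i, s = ({var i}, var i) ∧ ps = []) ∨
  (∃ F Δ Ξ, s.1 = {F} + (Δ + Ξ) ∧ ps ∈ leftPremises F Δ Ξ s.2) ∨
  ∃ Δ Ξ, s.1 = Δ + Ξ ∧ ps ∈ rightPremises s.2 Δ Ξ

theorem IsRule.derivable {s : Sequent} {ps : List Sequent} (h : IsRule s ps)
    (hps : ∀ p ∈ ps, Sequent.IsDerivable p) : s.IsDerivable := by
  obtain ⟨Γ, C⟩ := s
  rcases h with ⟨i, h, -⟩ | ⟨F, Δ, Ξ, rfl, h⟩ | ⟨Δ, Ξ, rfl, h⟩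
  · rw [h]; exact Derivable.id _
  · exact .of_leftPremises h hps
  · exact .of_rightPremises h hps

theorem CutFree.isRule_or_star {Γ : Multiset Formula} {C : Formula} (h : CutFree Γ C) :
    (∃ ps, IsRule (Γ, C) ps ∧ ∀ p ∈ ps, CutFree p.1 p.2) ∨ ∃ A, .star A ∈ Γ := by
  cases h with
  | var i => exact .inl ⟨[], .inl ⟨i, rfl, rfl⟩, by simp⟩
  | left F Δ Ξ _ ps hps h => exact .inl ⟨ps, .inr (.inl ⟨F, Δ, Ξ, rfl, hps⟩), h⟩
  | right Δ Ξ _ ps hps h => exact .inl ⟨ps, .inr (.inr ⟨Δ, Ξ, rfl, hps⟩), h⟩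
  | starL Γ A => exact .inr ⟨A, by simp⟩

/-- The Dershowitz–Manna ordering of sequents by the codes of their formulae. -/
def Sequent.LT (s t : Sequent) : Prop :=
  Multiset.IsDershowitzMannaLT ((s.1 + {s.2}).map toNat) ((t.1 + {t.2}).map toNat)

theorem Sequent.wellFounded_LT : WellFounded Sequent.LT :=
  InvImage.wf (fun s : Sequent => (s.1 + {s.2}).map toNat)
    Multiset.wellFounded_isDershowitzMannaLT

theorem Sequent.LT_of {s t : Sequent} (X Y Z : Multiset Formula) (hs : s.1 + {s.2} = X + Y)
    (ht : t.1 + {t.2} = X + Z) (hZ : Z ≠ 0) (h : ∀ A ∈ Y, ∃ B ∈ Z, A.toNat < B.toNat) :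
    s.LT t := by
  refine ⟨X.map toNat, Y.map toNat, Z.map toNat, by simpa using hZ, ?_, ?_, ?_⟩
  · rw [hs, Multiset.map_add]
  · rw [ht, Multiset.map_add]
  · simpa using h

theorem Formula.toNat_lt_star (A : Formula) : A.toNat < (Formula.star A).toNat := by
  rw [toNat]; omega

/-- The pairing function dominates the sum. The slack is for `Sequent.weight`, where each formula
counts one more than its code and a premise may trade one formula for two. -/
theorem Formula.add_toNat_lt (A B : Formula) :
    A.toNat + B.toNat + 3 < (imp A B).toNat ∧ A.toNat + B.toNat + 3 < (mul A B).toNat ∧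
    A.toNat + B.toNat + 3 < (sup A B).toNat ∧ A.toNat + B.toNat + 3 < (inf A B).toNat := by
  have := Nat.add_le_pair A.toNat B.toNat
  simp only [toNat]
  omega

theorem Sequent.LT_of_mem_leftPremises {F : Formula} {Δ Ξ : Multiset Formula} {C : Formula}
    {ps : List Sequent} (hps : ps ∈ leftPremises F Δ Ξ C) {p : Sequent} (hp : p ∈ ps) :
    p.LT ({F} + (Δ + Ξ), C) := by
  have ac (a b c d : Multiset Formula) : a + (b + c) + d = b + c + d + a := by
    rw [add_comm a, add_right_comm]
  cases F with
  | var i => simp [leftPremises] at hps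
  | zero => simp_all [leftPremises]
  | star A => simp [leftPremises] at hps
  | one =>
    simp only [leftPremises, List.mem_singleton] at hps
    subst hps
    obtain rfl := List.mem_singleton.1 hp
    exact LT_of (Δ + Ξ + {C}) 0 {one} (by simp) (ac _ _ _ _) (by simp) (by simp)
  | imp A B =>
    have := (add_toNat_lt A B).1
    simp only [leftPremises, List.mem_singleton] at hps
    subst hps
    simp only [List.mem_cons, List.not_mem_nil, or_false] at hp
    rcases hp with rfl | rfl
    · exact LT_of Δ {A} (Ξ + {C} + {imp A B}) rfl ((ac _ _ _ _).trans (by simp only [add_assoc]))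
        (by simp) (by simp; omega)
    · exact LT_of (Ξ + {C}) {B} (Δ + {imp A B}) (by dsimp only; abel)
        (by dsimp only; abel) (by simp) (by simp; omega)
  | mul A B =>
    have := (add_toNat_lt A B).2.1
    simp only [leftPremises, List.mem_singleton] at hps
    subst hps
    obtain rfl := List.mem_singleton.1 hp
    exact LT_of (Δ + Ξ + {C}) ({A} + {B}) {mul A B} (ac _ _ _ _) (ac _ _ _ _) (by simp)
      (by simp; omega)
  | sup A B =>
    have := (add_toNat_lt A B).2.2.1
    simp only [leftPremises, List.mem_singleton] at hps
    subst hps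
    simp only [List.mem_cons, List.not_mem_nil, or_false] at hp
    rcases hp with rfl | rfl
    · exact LT_of (Δ + Ξ + {C}) {A} {sup A B} (ac _ _ _ _) (ac _ _ _ _) (by simp)
        (by simp; omega)
    · exact LT_of (Δ + Ξ + {C}) {B} {sup A B} (ac _ _ _ _) (ac _ _ _ _) (by simp)
        (by simp; omega)
  | inf A B =>
    have := (add_toNat_lt A B).2.2.2
    simp only [leftPremises, List.mem_cons, List.not_mem_nil, or_false] at hps
    rcases hps with rfl | rfl <;> obtain rfl := List.mem_singleton.1 hp
    · exact LT_of (Δ + Ξ + {C}) {A} {inf A B} (ac _ _ _ _) (ac _ _ _ _) (by simp)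
        (by simp; omega)
    · exact LT_of (Δ + Ξ + {C}) {B} {inf A B} (ac _ _ _ _) (ac _ _ _ _) (by simp)
        (by simp; omega)

theorem Sequent.LT_of_mem_rightPremises {C : Formula} {Δ Ξ : Multiset Formula}
    {ps : List Sequent} (hps : ps ∈ rightPremises C Δ Ξ) {p : Sequent} (hp : p ∈ ps) :
    p.LT (Δ + Ξ, C) := by
  cases C with
  | var i => simp [rightPremises] at hps
  | zero => simp [rightPremises] at hps
  | one =>
    rw [rightPremises] at hps
    split_ifs at hps
    · obtain rfl := List.mem_singleton.1 hps
      simp at hp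
    · simp at hps
  | imp A B =>
    have := (add_toNat_lt A B).1
    simp only [rightPremises, List.mem_singleton] at hps
    subst hps
    obtain rfl := List.mem_singleton.1 hp
    exact LT_of (Δ + Ξ) ({A} + {B}) {imp A B} (by dsimp only; abel) rfl
      (by simp) (by simp; omega)
  | mul A B =>
    have := (add_toNat_lt A B).2.1
    simp only [rightPremises, List.mem_singleton] at hps
    subst hps
    simp only [List.mem_cons, List.not_mem_nil, or_false] at hp
    rcases hp with rfl | rfl
    · exact LT_of Δ {A} (Ξ + {mul A B}) rfl (by simp only [add_assoc]) (by simp)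
        (by simp; omega)
    · exact LT_of Ξ {B} (Δ + {mul A B}) rfl (by dsimp only; abel) (by simp)
        (by simp; omega)
  | sup A B =>
    have := (add_toNat_lt A B).2.2.1
    simp only [rightPremises, List.mem_cons, List.not_mem_nil, or_false] at hps
    rcases hps with rfl | rfl <;> obtain rfl := List.mem_singleton.1 hp
    · exact LT_of (Δ + Ξ) {A} {sup A B} rfl rfl (by simp) (by simp; omega)
    · exact LT_of (Δ + Ξ) {B} {sup A B} rfl rfl (by simp) (by simp; omega)
  | inf A B =>
    have := (add_toNat_lt A B).2.2.2
    simp only [rightPremises, List.mem_singleton] at hps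
    subst hps
    simp only [List.mem_cons, List.not_mem_nil, or_false] at hp
    rcases hp with rfl | rfl
    · exact LT_of (Δ + Ξ) {A} {inf A B} rfl rfl (by simp) (by simp; omega)
    · exact LT_of (Δ + Ξ) {B} {inf A B} rfl rfl (by simp) (by simp; omega)
  | star A =>
    have := toNat_lt_star A
    rw [rightPremises] at hps
    split_ifs at hps with h0 h1
    · obtain rfl := List.mem_singleton.1 hps
      simp at hp
    · simp at hps
    · rw [List.mem_singleton] at hps
      subst hps
      simp only [List.mem_cons, List.not_mem_nil, or_false] at hp
      rcases hp with rfl | rfl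
      · exact LT_of Δ {A} (Ξ + {.star A}) rfl (by simp only [add_assoc]) (by simp)
          (by simp; omega)
      -- The star formula survives in this premise, so the decrease comes only from the loss of the
      -- nonempty `Δ`.
      · exact LT_of (Ξ + {.star A}) 0 Δ (by simp) (by dsimp only; abel) h1
          (by simp)

theorem IsRule.LT {s : Sequent} {ps : List Sequent} (h : IsRule s ps) {p : Sequent}
    (hp : p ∈ ps) : p.LT s := by
  obtain ⟨Γ, C⟩ := s
  rcases h with ⟨i, -, rfl⟩ | ⟨F, Δ, Ξ, rfl, h⟩ | ⟨Δ, Ξ, rfl, h⟩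
  · simp at hp
  · exact Sequent.LT_of_mem_leftPremises h hp
  · exact Sequent.LT_of_mem_rightPremises h hp

/-- Any number of copies of `A` lies below the single formula A* in the multiset order. A sum of
codes would not decrease uniformly in `n`. -/
theorem Sequent.LT_starL (Γ : Multiset Formula) (A C : Formula) (n : ℕ) :
    Sequent.LT (Γ + replicate n A, C) (Γ + {.star A}, C) :=
  LT_of (Γ + {C}) (replicate n A) {.star A} (by dsimp only; abel)
    (by dsimp only; abel) (by simp)
    (fun B hB => ⟨_, Multiset.mem_singleton_self _,
      Multiset.eq_of_mem_replicate hB ▸ toNat_lt_star A⟩)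

/-! ### Lifting rule instances from an approximation to the sequent -/

theorem leftPremises_approx (n : ℕ) {F : Formula} (hF : ∀ A, F ≠ .star A)
    (Δ Ξ : Multiset Formula) (C : Formula) :
    leftPremises (F.approx n false) (Δ.map (Formula.approx n false))
      (Ξ.map (Formula.approx n false)) (C.approx n true) =
    (leftPremises F Δ Ξ C).map (List.map (Sequent.approx n)) := by
  cases F with
  | star A => exact absurd rfl (hF A)
  | _ => simp [leftPremises, Formula.approx, Sequent.approx]

/-- No exception for the star is needed: P_n keeps every main connective, and mapping a multiset
does not change whether it is empty. -/
theorem rightPremises_approx (n : ℕ) (Δ Ξ : Multiset Formula) (C : Formula) :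
    rightPremises (C.approx n true) (Δ.map (Formula.approx n false))
      (Ξ.map (Formula.approx n false)) =
    (rightPremises C Δ Ξ).map (List.map (Sequent.approx n)) := by
  cases C with
  | star A =>
    by_cases h0 : Δ = 0 <;> by_cases h1 : Ξ = 0 <;>
      simp [h0, h1, rightPremises, Sequent.approx, Formula.approx]
  | one =>
    by_cases h0 : Δ = 0 <;> by_cases h1 : Ξ = 0 <;> simp [h0, h1, rightPremises, Formula.approx]
  | _ => simp [rightPremises, Formula.approx, Sequent.approx]

theorem _root_.Multiset.exists_add_of_map_eq_add {α β : Type*} {f : α → β} {s : Multiset α}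
    {t u : Multiset β} (h : s.map f = t + u) :
    ∃ t' u', s = t' + u' ∧ t'.map f = t ∧ u'.map f = u := by
  classical
  induction t using Multiset.induction generalizing s with
  | empty => exact ⟨0, s, by simp, by simp, by simpa using h⟩
  | cons b t ih =>
    rw [Multiset.cons_add] at h
    obtain ⟨a, ha, rfl, h'⟩ := (Multiset.map_eq_cons f s (t + u) b).2 h
    obtain ⟨t', u', h₁, rfl, rfl⟩ := ih h'
    refine ⟨a ::ₘ t', u', ?_, by simp, rfl⟩
    rw [Multiset.cons_add, ← h₁, Multiset.cons_erase ha]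

/-- This lifts identity axioms, and it is why they are restricted to variables: for compound
formulae N_n(F) = P_n(C) does not force F = C, since N_n may turn a star inside F into a disjunction
already present in C. -/
theorem Formula.eq_var_of_approx {n : ℕ} {b : Bool} {A : Formula} {i : ℕ}
    (h : A.approx n b = var i) : A = var i := by
  cases A with
  | star A =>
    cases b
    · cases n <;> simp [approx, powLe] at h
    · simp [approx] at h
  | _ => simp_all [approx]

theorem IsRule.of_approx {s : Sequent} {n : ℕ} {qs : List Sequent} (h : IsRule (s.approx n) qs)
    (hs : ∀ A, .star A ∉ s.1) : ∃ ps, IsRule s ps ∧ ps.map (Sequent.approx n) = qs := by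
  obtain ⟨Γ, C⟩ := s
  rcases h with ⟨i, h, rfl⟩ | ⟨F, Δ, Ξ, h, hqs⟩ | ⟨Δ, Ξ, h, hqs⟩
  · obtain ⟨h₁, h₂⟩ := Prod.mk.inj h
    obtain ⟨A, rfl, h₃⟩ := Multiset.map_eq_singleton.1 h₁
    exact ⟨[], .inl ⟨i, Prod.ext (by rw [eq_var_of_approx h₃]) (eq_var_of_approx h₂), rfl⟩, rfl⟩
  · obtain ⟨F', Θ, rfl, hF, h⟩ := Multiset.exists_add_of_map_eq_add h
    obtain ⟨Δ, Ξ, rfl, rfl, rfl⟩ := Multiset.exists_add_of_map_eq_add h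
    obtain ⟨F, rfl, rfl⟩ := Multiset.map_eq_singleton.1 hF
    have hqs : qs ∈ leftPremises _ _ _ (C.approx n true) := hqs
    rw [leftPremises_approx n (by rintro A rfl; exact hs A (by simp)), List.mem_map] at hqs
    obtain ⟨ps, hps, rfl⟩ := hqs
    exact ⟨ps, .inr (.inl ⟨F, Δ, Ξ, rfl, hps⟩), rfl⟩
  · obtain ⟨Δ, Ξ, rfl, rfl, rfl⟩ := Multiset.exists_add_of_map_eq_add h
    have hqs : qs ∈ rightPremises (C.approx n true) _ _ := hqs
    rw [rightPremises_approx, List.mem_map] at hqs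
    obtain ⟨ps, hps, rfl⟩ := hqs
    exact ⟨ps, .inr (.inr ⟨Δ, Ξ, rfl, hps⟩), rfl⟩

theorem Formula.not_star_approx {n : ℕ} {A B : Formula} (hA : ∀ A', A ≠ .star A') :
    A.approx n false ≠ .star B := by
  cases A with
  | star A => exact absurd rfl (hA A)
  | _ => simp [approx]

theorem Sequent.exists_isRule_of_approx {s : Sequent} {n : ℕ} (h : (s.approx n).IsDerivable)
    (hs : ∀ A, .star A ∉ s.1) : ∃ ps, IsRule s ps ∧ ∀ p ∈ ps, (Sequent.approx n p).IsDerivable := by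
  rcases h.cutFree.isRule_or_star with ⟨qs, hr, hqs⟩ | ⟨A, hA⟩
  · obtain ⟨ps, hr', rfl⟩ := IsRule.of_approx hr hs
    exact ⟨ps, hr', fun p hp => (hqs _ (List.mem_map_of_mem hp)).derivable⟩
  · obtain ⟨B, hB, hBA⟩ := Multiset.mem_map.1 hA
    exact absurd hBA (not_star_approx fun A' h => hs A' (h ▸ hB))

/-! ### Finite enumeration of the rule instances of a sequent -/

instance : DecidableEq Formula := Encodable.decidableEqOfEncodable Formula

/-- A sequent with a list of formulae as the antecedent. -/
abbrev ListSequent : Type := List Formula × Formula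

/-- The sequent represented by `q`. -/
def ListSequent.toSequent (q : ListSequent) : Sequent := (↑q.1, q.2)

/-- `leftPremises` for lists. -/
def listLeft : Formula → List Formula → List Formula → Formula → List (List ListSequent)
  | var _, _, _, _ => []
  | zero, _, _, _ => [[]]
  | one, Δ, Ξ, C => [[(Δ ++ Ξ, C)]]
  | imp A B, Δ, Ξ, C => [[(Δ, A), (B :: Ξ, C)]]
  | mul A B, Δ, Ξ, C => [[(A :: B :: (Δ ++ Ξ), C)]]
  | sup A B, Δ, Ξ, C => [[(A :: (Δ ++ Ξ), C), (B :: (Δ ++ Ξ), C)]]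
  | inf A B, Δ, Ξ, C => [[(A :: (Δ ++ Ξ), C)], [(B :: (Δ ++ Ξ), C)]]
  | .star _, _, _, _ => []

/-- `rightPremises` for lists. -/
def listRight : Formula → List Formula → List Formula → List (List ListSequent)
  | var _, _, _ => []
  | zero, _, _ => []
  | one, Δ, Ξ => if Δ ++ Ξ = [] then [[]] else []
  | imp A B, Δ, Ξ => [[(A :: (Δ ++ Ξ), B)]]
  | mul A B, Δ, Ξ => [[(Δ, A), (Ξ, B)]]
  | sup A B, Δ, Ξ => [[(Δ ++ Ξ, A)], [(Δ ++ Ξ, B)]]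
  | inf A B, Δ, Ξ => [[(Δ ++ Ξ, A), (Δ ++ Ξ, B)]]
  | .star A, Δ, Ξ =>
    if Δ ++ Ξ = [] then [[]] else if Δ = [] then [] else [[(Δ, A), (Ξ, .star A)]]

/-- The premises of the identity axiom for variables, if it has the conclusion `Γ ⊢ C`. -/
def listId : Formula → List Formula → List (List ListSequent)
  | var i, Γ => if Γ = [var i] then [[]] else []
  | _, _ => []

theorem leftPremises_coe (F : Formula) (Δ Ξ : List Formula) (C : Formula) :
    leftPremises F Δ Ξ C = (listLeft F Δ Ξ C).map (List.map ListSequent.toSequent) := by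
  cases F <;> simp [leftPremises, listLeft, ListSequent.toSequent]

theorem rightPremises_coe (C : Formula) (Δ Ξ : List Formula) :
    rightPremises C Δ Ξ = (listRight C Δ Ξ).map (List.map ListSequent.toSequent) := by
  cases C with
  | one =>
    by_cases h0 : Δ = [] <;> by_cases h1 : Ξ = [] <;> simp [h0, h1, rightPremises, listRight]
  | star A =>
    by_cases h0 : Δ = [] <;> by_cases h1 : Ξ = [] <;>
      simp [h0, h1, rightPremises, listRight, ListSequent.toSequent]
  | _ => simp [rightPremises, listRight, ListSequent.toSequent]

/-- The ways to split a list into two complementary sublists. -/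
def splits {α : Type*} : List α → List (List α × List α)
  | [] => [([], [])]
  | a :: l => (splits l).flatMap fun p => [(a :: p.1, p.2), (p.1, a :: p.2)]

theorem coe_add_of_mem_splits {α : Type*} {l : List α} {p : List α × List α}
    (h : p ∈ splits l) : (l : Multiset α) = ↑p.1 + ↑p.2 := by
  induction l generalizing p with
  | nil =>
    obtain rfl := List.mem_singleton.1 h
    rfl
  | cons a l ih =>
    rw [splits, List.mem_flatMap] at h
    obtain ⟨q, hq, h⟩ := h
    simp only [List.mem_cons, List.not_mem_nil, or_false] at h
    rw [← Multiset.cons_coe, ih hq]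
    rcases h with rfl | rfl <;> simp [← Multiset.cons_coe, -Multiset.coe_add]

theorem exists_mem_splits {α : Type*} {l : List α} {s t : Multiset α}
    (h : (l : Multiset α) = s + t) :
    ∃ p ∈ splits l, (p.1 : Multiset α) = s ∧ (p.2 : Multiset α) = t := by
  induction l generalizing s t with
  | nil =>
    have h' : s = 0 ∧ t = 0 := by simpa using h.symm
    exact ⟨([], []), by simp [splits], h'.1.symm, h'.2.symm⟩
  | cons a l ih =>
    rw [← Multiset.cons_coe] at h
    have ha : a ∈ s + t := h ▸ Multiset.mem_cons_self a _
    rcases Multiset.mem_add.1 ha with ha | ha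
    · obtain ⟨s, rfl⟩ := Multiset.exists_cons_of_mem ha
      rw [Multiset.cons_add, Multiset.cons_inj_right] at h
      obtain ⟨p, hp, rfl, rfl⟩ := ih h
      exact ⟨(a :: p.1, p.2), List.mem_flatMap.2 ⟨p, hp, by simp⟩, rfl, rfl⟩
    · obtain ⟨t, rfl⟩ := Multiset.exists_cons_of_mem ha
      rw [Multiset.add_cons, Multiset.cons_inj_right] at h
      obtain ⟨p, hp, rfl, rfl⟩ := ih h
      exact ⟨(p.1, a :: p.2), List.mem_flatMap.2 ⟨p, hp, by simp⟩, rfl, rfl⟩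

/-- The possible lists of premises of the cut-free rules other than the ω-rule. -/
def listRules (q : ListSequent) : List (List ListSequent) :=
  listId q.2 q.1 ++ (splits q.1).flatMap fun p =>
    -- The loop over `p.1` with the test `p.1 = [F]` selects the splits whose first part is a single
    -- principal formula.
    listRight q.2 p.1 p.2 ++ p.1.flatMap fun F =>
      if p.1 = [F] then (splits p.2).flatMap fun r => listLeft F r.1 r.2 q.2 else []

theorem isRule_toSequent {q : ListSequent} {ps : List Sequent} :
    IsRule q.toSequent ps ↔ ∃ qs ∈ listRules q, qs.map ListSequent.toSequent = ps := by
  obtain ⟨l, C⟩ := q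
  constructor
  · rintro (⟨i, h, rfl⟩ | ⟨F, Δ, Ξ, h, hps⟩ | ⟨Δ, Ξ, h, hps⟩)
    · obtain ⟨h₁, rfl⟩ := Prod.mk.inj h
      obtain rfl : l = [var i] := Multiset.coe_eq_singleton.1 h₁
      exact ⟨[], by simp [listRules, listId], rfl⟩
    · obtain ⟨p, hp, h₁, h₂⟩ := exists_mem_splits h
      obtain ⟨r, hr, rfl, rfl⟩ := exists_mem_splits h₂
      have h₁ := Multiset.coe_eq_singleton.1 h₁
      rw [leftPremises_coe, List.mem_map] at hps
      obtain ⟨qs, hqs, rfl⟩ := hps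
      refine ⟨qs, ?_, rfl⟩
      refine List.mem_append_right _ (List.mem_flatMap.2 ⟨p, hp, List.mem_append_right _ ?_⟩)
      refine List.mem_flatMap.2 ⟨F, by simp [h₁], ?_⟩
      rw [if_pos h₁]
      exact List.mem_flatMap.2 ⟨r, hr, hqs⟩
    · obtain ⟨p, hp, rfl, rfl⟩ := exists_mem_splits h
      rw [rightPremises_coe, List.mem_map] at hps
      obtain ⟨qs, hqs, rfl⟩ := hps
      exact ⟨qs, List.mem_append_right _
        (List.mem_flatMap.2 ⟨p, hp, List.mem_append_left _ hqs⟩), rfl⟩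
  · rintro ⟨qs, hq, rfl⟩
    rcases List.mem_append.1 hq with hqs | hqs
    · cases C with
      | var i =>
        simp only [listId] at hqs
        split_ifs at hqs with h
        · subst h
          rw [List.mem_singleton] at hqs
          subst hqs
          exact .inl ⟨i, rfl, rfl⟩
        · simp at hqs
      | _ => simp [listId] at hqs
    · obtain ⟨⟨l₁, l₂⟩, hp, hqs⟩ := List.mem_flatMap.1 hqs
      have hl := coe_add_of_mem_splits hp
      rcases List.mem_append.1 hqs with hqs | hqs
      · refine .inr (.inr ⟨l₁, l₂, hl, ?_⟩)
        rw [rightPremises_coe]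
        exact List.mem_map_of_mem hqs
      · obtain ⟨F, -, hqs⟩ := List.mem_flatMap.1 hqs
        split_ifs at hqs with h
        · obtain ⟨r, hr, hqr⟩ := List.mem_flatMap.1 hqs
          simp only at h
          subst h
          refine .inr (.inl ⟨F, r.1, r.2, ?_, ?_⟩)
          · rw [← coe_add_of_mem_splits hr]
            exact hl
          · rw [leftPremises_coe]
            exact List.mem_map_of_mem hqr
        · simp at hqs

theorem finite_setOf_isRule (s : Sequent) : {ps | IsRule s ps}.Finite := by
  obtain ⟨Γ, C⟩ := s
  induction Γ using Quotient.inductionOn with | _ l =>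
  refine ((List.finite_toSet (listRules (l, C))).image
    (List.map ListSequent.toSequent)).subset fun ps hps => ?_
  obtain ⟨qs, hqs, rfl⟩ := (isRule_toSequent (q := (l, C))).1 hps
  exact ⟨qs, hqs, rfl⟩

/-- A star in the antecedent is always decomposed first, by the ω-rule; only when none is left is a
rule chosen by the pigeonhole principle. -/
theorem Sequent.isDerivable_of_approx {s : Sequent} (h : ∀ n, (s.approx n).IsDerivable) :
    s.IsDerivable := by
  induction s using wellFounded_LT.induction with | _ s ih =>
  by_cases hs : ∃ A, .star A ∈ s.1
  · obtain ⟨Γ, C⟩ := s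
    obtain ⟨A, hA⟩ := hs
    obtain ⟨Γ, rfl⟩ := Multiset.exists_cons_of_mem hA
    rw [← singleton_add, add_comm] at h ih ⊢
    refine .starL _ _ _ fun k => ih (Γ + replicate k A, C) (LT_starL _ _ _ _) fun n => ?_
    -- At an index at least `k` the disjunction replacing A* contains the `k`-th power, so it can be
    -- cut against `k` copies of N(A). Monotonicity then goes back down to `n`.
    refine IsDerivable.approx_of_le (m := max n k) ?_ (le_max_left _ _)
    have hm := h (max n k)
    simp only [IsDerivable, approx, Multiset.map_add, Multiset.map_singleton,
      Multiset.map_replicate, Formula.approx] at hm ⊢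
    exact .cut _ _ _ _ (.powLe_intro (le_max_right n k) (.pow_intro (.id _) k)) hm
  · push Not at hs
    have hex n := exists_isRule_of_approx (h n) hs
    -- Pigeonhole: if each of the finitely many rule instances failed from some index on, all would
    -- fail at a common index, where one of them must work.
    obtain ⟨ps, hps, hfr⟩ : ∃ ps ∈ {ps | IsRule s ps}, ∃ᶠ n in Filter.atTop,
        ∀ p ∈ ps, (Sequent.approx n p).IsDerivable := by
      by_contra! hcon
      have := ((finite_setOf_isRule s).eventually_all).2 hcon
      obtain ⟨n, hn⟩ := this.exists
      obtain ⟨ps, hps, hn'⟩ := hex n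
      obtain ⟨p, hp, hn⟩ := hn ps hps
      exact hn (hn' p hp)
    refine IsRule.derivable hps fun p hp => ih p (hps.LT hp) fun n => ?_
    obtain ⟨m, hm, hnm⟩ := Filter.frequently_atTop.1 hfr n
    exact IsDerivable.approx_of_le (hnm p hp) hm

/-! ### Terminating proof search in the absence of negative stars -/

theorem noNegStar_of_mem_leftPremises {F : Formula} {Δ Ξ : Multiset Formula} {C : Formula}
    {ps : List Sequent} (hps : ps ∈ leftPremises F Δ Ξ C) {p : Sequent} (hp : p ∈ ps)
    (h : Sequent.NoNegStar ({F} + (Δ + Ξ), C)) : p.NoNegStar := by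
  simp only [Sequent.NoNegStar, Multiset.mem_add, Multiset.mem_singleton,
    or_imp, forall_and] at h
  obtain ⟨⟨hF, hΔ, hΞ⟩, hC⟩ := h
  cases F <;> simp only [leftPremises, List.mem_cons, List.not_mem_nil, or_false] at hps <;>
    rcases hps with rfl | rfl <;>
    simp only [List.mem_cons, List.not_mem_nil, or_false] at hp <;>
    rcases hp with rfl | rfl <;>
    simp_all [Sequent.NoNegStar, Formula.NoStar, or_imp, forall_and]

theorem noNegStar_of_mem_rightPremises {C : Formula} {Δ Ξ : Multiset Formula}
    {ps : List Sequent} (hps : ps ∈ rightPremises C Δ Ξ) {p : Sequent} (hp : p ∈ ps)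
    (h : Sequent.NoNegStar (Δ + Ξ, C)) : p.NoNegStar := by
  simp only [Sequent.NoNegStar, Multiset.mem_add, or_imp, forall_and] at h
  obtain ⟨⟨hΔ, hΞ⟩, hC⟩ := h
  cases C <;> simp only [rightPremises] at hps <;> (try split_ifs at hps) <;>
    simp only [List.mem_cons, List.not_mem_nil, or_false] at hps <;>
    rcases hps with rfl | rfl <;>
    simp only [List.mem_cons, List.not_mem_nil, or_false] at hp <;>
    rcases hp with rfl | rfl <;>
    simp_all [Sequent.NoNegStar, Formula.NoStar, or_imp]

theorem IsRule.noNegStar {s : Sequent} {ps : List Sequent} (h : IsRule s ps) {p : Sequent}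
    (hp : p ∈ ps) (hs : s.NoNegStar) : p.NoNegStar := by
  obtain ⟨Γ, C⟩ := s
  rcases h with ⟨i, -, rfl⟩ | ⟨F, Δ, Ξ, rfl, h⟩ | ⟨Δ, Ξ, rfl, h⟩
  · simp at hp
  · exact noNegStar_of_mem_leftPremises h hp hs
  · exact noNegStar_of_mem_rightPremises h hp hs

/-- A measure of the size of a sequent. -/
def Sequent.weight (s : Sequent) : ℕ := ((s.1 + {s.2}).map fun A => A.toNat + 1).sum

/-- The summand 1 matters because `zero` has code 0; without it, splitting off copies of `zero` in
the star rule would not lower the weight. -/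
theorem sum_map_succ_pos {Γ : Multiset Formula} (h : Γ ≠ 0) :
    0 < (Γ.map fun A => A.toNat + 1).sum := by
  obtain ⟨A, hA⟩ := Multiset.exists_mem_of_ne_zero h
  obtain ⟨Γ, rfl⟩ := Multiset.exists_cons_of_mem hA
  rw [Multiset.map_cons, Multiset.sum_cons]
  omega

theorem weight_lt_of_mem_leftPremises {F : Formula} {Δ Ξ : Multiset Formula} {C : Formula}
    {ps : List Sequent} (hps : ps ∈ leftPremises F Δ Ξ C) {p : Sequent} (hp : p ∈ ps) :
    p.weight < Sequent.weight ({F} + (Δ + Ξ), C) := by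
  cases F <;> simp only [leftPremises, List.mem_cons, List.not_mem_nil, or_false] at hps <;>
    rcases hps with rfl | rfl <;>
    simp only [List.mem_cons, List.not_mem_nil, or_false] at hp <;>
    rcases hp with rfl | rfl <;>
    simp only [Sequent.weight, Multiset.map_add, Multiset.sum_add, Multiset.map_singleton,
      Multiset.sum_singleton] <;>
    first
    | (rename_i A B; have := add_toNat_lt A B; omega)
    | omega

theorem weight_lt_of_mem_rightPremises {C : Formula} {Δ Ξ : Multiset Formula}
    {ps : List Sequent} (hps : ps ∈ rightPremises C Δ Ξ) {p : Sequent} (hp : p ∈ ps) :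
    p.weight < Sequent.weight (Δ + Ξ, C) := by
  cases C with
  | star A =>
    have := toNat_lt_star A
    rw [rightPremises] at hps
    split_ifs at hps with h0 h1 <;>
      simp only [List.mem_cons, List.not_mem_nil, or_false] at hps <;> subst hps <;>
      simp only [List.mem_cons, List.not_mem_nil, or_false] at hp
    have := sum_map_succ_pos h1
    rcases hp with rfl | rfl <;>
    simp only [Sequent.weight, Multiset.map_add, Multiset.sum_add, Multiset.map_singleton,
      Multiset.sum_singleton] <;> omega
  | one =>
    rw [rightPremises] at hps
    split_ifs at hps <;>
      simp only [List.mem_cons, List.not_mem_nil, or_false] at hps <;> (subst hps; simp at hp)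
  | _ =>
    simp only [rightPremises, List.mem_cons, List.not_mem_nil, or_false] at hps <;>
    rcases hps with rfl | rfl <;>
    simp only [List.mem_cons, List.not_mem_nil, or_false] at hp <;>
    rcases hp with rfl | rfl <;>
    simp only [Sequent.weight, Multiset.map_add, Multiset.sum_add, Multiset.map_singleton,
      Multiset.sum_singleton] <;>
    (rename_i A B; have := add_toNat_lt A B; omega)

/-- With the ω-rule excluded, a measure in ℕ suffices, and course-of-values recursion requires one.
-/
theorem IsRule.weight_lt {s : Sequent} {ps : List Sequent} (h : IsRule s ps) {p : Sequent}
    (hp : p ∈ ps) : p.weight < s.weight := by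
  obtain ⟨Γ, C⟩ := s
  rcases h with ⟨i, -, rfl⟩ | ⟨F, Δ, Ξ, rfl, h⟩ | ⟨Δ, Ξ, rfl, h⟩
  · simp at hp
  · exact weight_lt_of_mem_leftPremises h hp
  · exact weight_lt_of_mem_rightPremises h hp

/-- Derivability by `listRules`. -/
inductive RuleDerivable : ListSequent → Prop
  | mk (q : ListSequent) (ps : List ListSequent) :
      ps ∈ listRules q → (∀ p ∈ ps, RuleDerivable p) → RuleDerivable q

theorem ruleDerivable_iff {q : ListSequent} :
    RuleDerivable q ↔ ∃ ps ∈ listRules q, ∀ p ∈ ps, RuleDerivable p :=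
  ⟨fun ⟨_, ps, h, h'⟩ => ⟨ps, h, h'⟩, fun ⟨ps, h, h'⟩ => ⟨q, ps, h, h'⟩⟩

theorem RuleDerivable.isDerivable {q : ListSequent} (h : RuleDerivable q) :
    q.toSequent.IsDerivable := by
  induction h with
  | mk q ps hps _ ih =>
    refine (isRule_toSequent.2 ⟨ps, hps, rfl⟩).derivable fun p hp => ?_
    obtain ⟨r, hr, rfl⟩ := List.mem_map.1 hp
    exact ih r hr

theorem RuleDerivable.of_isRule {q : ListSequent} {ps : List Sequent}
    (h : IsRule q.toSequent ps) (hq : q.toSequent.NoNegStar)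
    (hps : ∀ p ∈ ps, p.NoNegStar → ∀ r : ListSequent, r.toSequent = p → RuleDerivable r) :
    RuleDerivable q := by
  obtain ⟨qs, hqs, rfl⟩ := isRule_toSequent.1 h
  exact ⟨q, qs, hqs, fun r hr => hps _ (List.mem_map_of_mem hr)
    (h.noNegStar (List.mem_map_of_mem hr) hq) r rfl⟩

/-- The claim covers every list representing the antecedent, since the enumeration may produce
premises with their formulae in any order. -/
theorem CutFree.ruleDerivable {Γ : Multiset Formula} {C : Formula} (h : CutFree Γ C)
    (hs : Sequent.NoNegStar (Γ, C)) :
    ∀ r : ListSequent, r.toSequent = (Γ, C) → RuleDerivable r := by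
  induction h with
  | var i => exact fun r hr => .of_isRule (.inl ⟨i, hr, rfl⟩) (hr ▸ hs) (by simp)
  | left F Δ Ξ C ps hps _ ih =>
    exact fun r hr => .of_isRule (hr ▸ .inr (.inl ⟨F, Δ, Ξ, rfl, hps⟩)) (hr ▸ hs) ih
  | right Δ Ξ C ps hps _ ih =>
    exact fun r hr => .of_isRule (hr ▸ .inr (.inr ⟨Δ, Ξ, rfl, hps⟩)) (hr ▸ hs) ih
  | starL Γ A C _ ih => exact (hs.1 (.star A) (by simp)).elim

theorem ruleDerivable_iff_isDerivable {q : ListSequent} (hq : q.toSequent.NoNegStar) :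
    RuleDerivable q ↔ q.toSequent.IsDerivable :=
  ⟨fun h => h.isDerivable, fun h => h.cutFree.ruleDerivable hq q rfl⟩

/-! ### Primitive recursiveness of proof search and of the approximations -/

open Encodable Denumerable Primrec

section

variable {α σ : Type*} [Primcodable α] [Primcodable σ]

theorem Formula.encode_eq (A : Formula) : encode A = A.toNat := rfl

theorem Formula.ofNat_eq (k : ℕ) : Denumerable.ofNat Formula k = Formula.ofNat k := rfl

theorem primrec_mul_add (c d : ℕ) {f : α → ℕ} (hf : Primrec f) :
    Primrec fun a => c * f a + d :=
  nat_add.comp (nat_mul.comp (.const c) hf) (.const d)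

theorem primrec_imp : Primrec₂ imp :=
  Primrec₂.encode_iff.1 <| (primrec_mul_add 6 4
    (Primrec₂.natPair.comp (Primrec.encode.comp fst) (Primrec.encode.comp snd))).to₂

theorem primrec_mul : Primrec₂ mul :=
  Primrec₂.encode_iff.1 <| (primrec_mul_add 6 5
    (Primrec₂.natPair.comp (Primrec.encode.comp fst) (Primrec.encode.comp snd))).to₂

theorem primrec_sup : Primrec₂ Formula.sup :=
  Primrec₂.encode_iff.1 <| (primrec_mul_add 6 6
    (Primrec₂.natPair.comp (Primrec.encode.comp fst) (Primrec.encode.comp snd))).to₂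

theorem primrec_inf : Primrec₂ Formula.inf :=
  Primrec₂.encode_iff.1 <| (primrec_mul_add 6 7
    (Primrec₂.natPair.comp (Primrec.encode.comp fst) (Primrec.encode.comp snd))).to₂

theorem primrec_star : Primrec Formula.star :=
  Primrec.encode_iff.1 <| primrec_mul_add 6 3 Primrec.encode

theorem primrec_var : Primrec var :=
  Primrec.encode_iff.1 <| primrec_mul_add 6 2 Primrec.id

/-- Case distinction. -/
def Formula.elimCases (A : Formula) (v : ℕ → σ) (z o : σ) (im mu su nf : Formula × Formula → σ)
    (st : Formula → σ) : σ :=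
  match A with
  | var i => v i
  | zero => z
  | one => o
  | imp A B => im (A, B)
  | mul A B => mu (A, B)
  | sup A B => su (A, B)
  | inf A B => nf (A, B)
  | .star A => st A

theorem primrec_elimCases {F : α → Formula} {v : α → ℕ → σ} {z o : α → σ}
    {im mu su nf : α → Formula × Formula → σ} {st : α → Formula → σ} (hF : Primrec F)
    (hv : Primrec₂ v) (hz : Primrec z) (ho : Primrec o) (him : Primrec₂ im)
    (hmu : Primrec₂ mu) (hsu : Primrec₂ su) (hnf : Primrec₂ nf) (hst : Primrec₂ st) :
    Primrec fun a =>
      (F a).elimCases (v a) (z a) (o a) (im a) (mu a) (su a) (nf a) (st a) := by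
  have hk : Primrec fun a => encode (F a) := Primrec.encode.comp hF
  -- Quotient and remainder of the code minus 2 recover the arguments and the constructor. Truncated
  -- subtraction is harmless, as the codes 0 and 1 are tested first.
  have hm : Primrec fun a => (encode (F a) - 2) / 6 :=
    nat_div.comp (nat_sub.comp hk (.const 2)) (.const 6)
  have hr : Primrec fun a => (encode (F a) - 2) % 6 :=
    nat_mod.comp (nat_sub.comp hk (.const 2)) (.const 6)
  have hu := Primrec.unpair.comp hm
  have hp : Primrec fun a => (Denumerable.ofNat Formula ((encode (F a) - 2) / 6).unpair.1,
      Denumerable.ofNat Formula ((encode (F a) - 2) / 6).unpair.2) :=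
    ((Primrec.ofNat Formula).comp (fst.comp hu)).pair ((Primrec.ofNat Formula).comp (snd.comp hu))
  refine (Primrec.ite (Primrec.eq.comp hk (.const 0)) hz <|
    Primrec.ite (Primrec.eq.comp hk (.const 1)) ho <|
    Primrec.ite (Primrec.eq.comp hr (.const 0)) (hv.comp .id hm) <|
    Primrec.ite (Primrec.eq.comp hr (.const 1))
      (hst.comp .id ((Primrec.ofNat Formula).comp hm)) <|
    Primrec.ite (Primrec.eq.comp hr (.const 2)) (him.comp .id hp) <|
    Primrec.ite (Primrec.eq.comp hr (.const 3)) (hmu.comp .id hp) <|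
    Primrec.ite (Primrec.eq.comp hr (.const 4)) (hsu.comp .id hp) (hnf.comp .id hp)).of_eq
    fun a => ?_
  have h3 (x : ℕ) : 6 * x + 3 - 2 = 6 * x + 1 := by omega
  have h4 (x : ℕ) : 6 * x + 4 - 2 = 6 * x + 2 := by omega
  have h5 (x : ℕ) : 6 * x + 5 - 2 = 6 * x + 3 := by omega
  have h6 (x : ℕ) : 6 * x + 6 - 2 = 6 * x + 4 := by omega
  have h7 (x : ℕ) : 6 * x + 7 - 2 = 6 * x + 5 := by omega
  have hd (x d : ℕ) (hd : d < 6) : (6 * x + d) / 6 = x := by omega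
  have hmod (x d : ℕ) : (6 * x + d) % 6 = d % 6 := by omega
  cases F a <;>
    simp [Formula.encode_eq, Formula.ofNat_eq, Formula.toNat, Formula.elimCases, h3, h4, h5, h6, h7, hd,
      hmod, ofNat_toNat]

theorem primrec_singleton {β : Type*} [Primcodable β] {f : α → β} (hf : Primrec f) :
    Primrec fun a => [f a] :=
  list_cons.comp hf (.const [])

theorem primrec_pair_list {β : Type*} [Primcodable β] {f g : α → β} (hf : Primrec f)
    (hg : Primrec g) : Primrec fun a => [f a, g a] :=
  list_cons.comp hf (primrec_singleton hg)

theorem primrec_listLeft {F C : α → Formula} {Δ Ξ : α → List Formula} (hF : Primrec F)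
    (hΔ : Primrec Δ) (hΞ : Primrec Ξ) (hC : Primrec C) :
    Primrec fun a => listLeft (F a) (Δ a) (Ξ a) (C a) := by
  have hΔ' : Primrec fun x : α × Formula × Formula => Δ x.1 := hΔ.comp fst
  have hΞ' : Primrec fun x : α × Formula × Formula => Ξ x.1 := hΞ.comp fst
  have hC' : Primrec fun x : α × Formula × Formula => C x.1 := hC.comp fst
  have hA : Primrec fun x : α × Formula × Formula => x.2.1 := fst.comp snd
  have hB : Primrec fun x : α × Formula × Formula => x.2.2 := snd.comp snd
  have happ := list_append.comp hΔ' hΞ'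
  have hAC := (list_cons.comp hA happ).pair hC'
  have hBC := (list_cons.comp hB happ).pair hC'
  refine (primrec_elimCases (v := fun _ _ => []) (z := fun _ => [[]])
    (o := fun a => [[(Δ a ++ Ξ a, C a)]]) (im := fun a p => [[(Δ a, p.1), (p.2 :: Ξ a, C a)]])
    (mu := fun a p => [[(p.1 :: p.2 :: (Δ a ++ Ξ a), C a)]])
    (su := fun a p => [[(p.1 :: (Δ a ++ Ξ a), C a), (p.2 :: (Δ a ++ Ξ a), C a)]])
    (nf := fun a p => [[(p.1 :: (Δ a ++ Ξ a), C a)], [(p.2 :: (Δ a ++ Ξ a), C a)]])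
    (st := fun _ _ => []) hF (Primrec₂.const _) (.const _)
    (primrec_singleton (primrec_singleton ((list_append.comp hΔ hΞ).pair hC)))
    (primrec_singleton (primrec_pair_list (hΔ'.pair hA)
      ((list_cons.comp hB hΞ').pair hC'))).to₂
    (primrec_singleton (primrec_singleton
      ((list_cons.comp hA (list_cons.comp hB happ)).pair hC'))).to₂
    (primrec_singleton (primrec_pair_list hAC hBC)).to₂
    (primrec_pair_list (primrec_singleton hAC) (primrec_singleton hBC)).to₂
    (Primrec₂.const _)).of_eq fun a => ?_
  cases F a <;> rfl

theorem primrec_listRight {C : α → Formula} {Δ Ξ : α → List Formula} (hC : Primrec C)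
    (hΔ : Primrec Δ) (hΞ : Primrec Ξ) :
    Primrec fun a => listRight (C a) (Δ a) (Ξ a) := by
  have hΔ' : Primrec fun x : α × Formula × Formula => Δ x.1 := hΔ.comp fst
  have hΞ' : Primrec fun x : α × Formula × Formula => Ξ x.1 := hΞ.comp fst
  have hA : Primrec fun x : α × Formula × Formula => x.2.1 := fst.comp snd
  have hB : Primrec fun x : α × Formula × Formula => x.2.2 := snd.comp snd
  have happ := list_append.comp hΔ' hΞ'
  have hap := list_append.comp hΔ hΞ
  refine (primrec_elimCases (v := fun _ _ => []) (z := fun _ => [])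
    (o := fun a => if Δ a ++ Ξ a = [] then [[]] else [])
    (im := fun a p => [[(p.1 :: (Δ a ++ Ξ a), p.2)]])
    (mu := fun a p => [[(Δ a, p.1), (Ξ a, p.2)]])
    (su := fun a p => [[(Δ a ++ Ξ a, p.1)], [(Δ a ++ Ξ a, p.2)]])
    (nf := fun a p => [[(Δ a ++ Ξ a, p.1), (Δ a ++ Ξ a, p.2)]])
    (st := fun a A => if Δ a ++ Ξ a = [] then [[]] else if Δ a = [] then []
      else [[(Δ a, A), (Ξ a, .star A)]]) hC (Primrec₂.const _) (.const _)
    (Primrec.ite (Primrec.eq.comp hap (.const [])) (.const _) (.const _))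
    (primrec_singleton (primrec_singleton ((list_cons.comp hA happ).pair hB))).to₂
    (primrec_singleton (primrec_pair_list (hΔ'.pair hA) (hΞ'.pair hB))).to₂
    (primrec_pair_list (primrec_singleton (happ.pair hA))
      (primrec_singleton (happ.pair hB))).to₂
    (primrec_singleton (primrec_pair_list (happ.pair hA) (happ.pair hB))).to₂
    (Primrec.ite (Primrec.eq.comp (hap.comp fst) (.const [])) (.const _)
      (Primrec.ite (Primrec.eq.comp (hΔ.comp fst) (.const [])) (.const _)
        (primrec_singleton (primrec_pair_list ((hΔ.comp fst).pair snd)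
          ((hΞ.comp fst).pair (primrec_star.comp snd)))))).to₂).of_eq fun a => ?_
  cases C a <;> rfl

theorem primrec_listId {C : α → Formula} {Γ : α → List Formula} (hC : Primrec C)
    (hΓ : Primrec Γ) : Primrec fun a => listId (C a) (Γ a) := by
  refine (primrec_elimCases (v := fun a i => if Γ a = [var i] then [[]] else [])
    (z := fun _ => []) (o := fun _ => []) (im := fun _ _ => []) (mu := fun _ _ => [])
    (su := fun _ _ => []) (nf := fun _ _ => []) (st := fun _ _ => []) hC
    (Primrec.ite (Primrec.eq.comp (hΓ.comp fst) (primrec_singleton (primrec_var.comp snd)))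
      (.const _) (.const _)).to₂
    (.const _) (.const _) (Primrec₂.const _) (Primrec₂.const _) (Primrec₂.const _)
    (Primrec₂.const _) (Primrec₂.const _)).of_eq fun a => ?_
  cases C a <;> rfl

theorem primrec_splits : Primrec (splits : List α → List (List α × List α)) := by
  refine (list_foldr (f := id) (g := fun _ => [([], [])])
    (h := fun _ x => x.2.flatMap fun p => [(x.1 :: p.1, p.2), (p.1, x.1 :: p.2)])
    .id (.const _) ?_).of_eq fun l => ?_
  · refine Primrec₂.mk (list_flatMap (snd.comp snd) (Primrec₂.mk ?_))
    have ha : Primrec fun x : (List α × α × List (List α × List α)) × List α × List α =>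
      x.1.2.1 := fst.comp (snd.comp fst)
    have h₁ : Primrec fun x : (List α × α × List (List α × List α)) × List α × List α =>
      x.2.1 := fst.comp snd
    have h₂ : Primrec fun x : (List α × α × List (List α × List α)) × List α × List α =>
      x.2.2 := snd.comp snd
    exact primrec_pair_list ((list_cons.comp ha h₁).pair h₂)
      (h₁.pair (list_cons.comp ha h₂))
  · induction l with
    | nil => rfl
    | cons a l ih =>
      rw [splits, ← ih]
      rfl

theorem primrec_listRules : Primrec listRules := by
  unfold listRules
  refine list_append.comp (primrec_listId snd fst) ?_
  refine list_flatMap (primrec_splits.comp fst) (Primrec₂.mk ?_)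
  refine list_append.comp
    (primrec_listRight (snd.comp fst) (fst.comp snd) (snd.comp snd)) ?_
  refine list_flatMap (fst.comp snd) (Primrec₂.mk ?_)
  refine Primrec.ite (Primrec.eq.comp (fst.comp (snd.comp fst)) (primrec_singleton snd)) ?_
    (.const _)
  refine list_flatMap (primrec_splits.comp (snd.comp (snd.comp fst))) (Primrec₂.mk ?_)
  exact primrec_listLeft (snd.comp fst) (fst.comp snd) (snd.comp snd)
    (snd.comp (fst.comp (fst.comp fst)))

theorem primrec_weight : Primrec fun q : ListSequent => q.toSequent.weight := by
  refine (list_foldr (f := fun q : ListSequent => q.1) (g := fun q => encode q.2 + 1)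
    (h := fun _ x => encode x.1 + 1 + x.2) fst (succ.comp (Primrec.encode.comp snd))
    (nat_add.comp (succ.comp (Primrec.encode.comp (fst.comp snd)))
      (snd.comp snd)).to₂).of_eq fun q => ?_
  obtain ⟨l, C⟩ := q
  induction l with
  | nil => rfl
  | cons A l ih =>
    simp only [List.foldr_cons] at ih ⊢
    rw [ih]
    simp [Sequent.weight, ListSequent.toSequent, Formula.encode_eq, add_assoc]

theorem primrecRel_mem : PrimrecRel fun (a : α) (l : List α) => a ∈ l :=
  ((PrimrecRel.exists_mem_list (Primrec.eq (α := α))).swap).of_eq fun a l => by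
    simp [Function.swap]

open scoped Classical in
theorem primrecPred_ruleDerivable : PrimrecPred RuleDerivable := by
  -- The recursion sees only the list of earlier values, so each value carries its own sequent:
  -- flattening that list yields exactly the derivable premises, and derivability of a premise
  -- becomes membership.
  have hf : Primrec fun q => if RuleDerivable q then [q] else [] := by
    have hex : PrimrecPred fun x : ListSequent × List (List ListSequent) =>
        ∃ ps ∈ listRules x.1, ∀ p ∈ ps, p ∈ x.2.flatten :=
      (PrimrecRel.exists_mem_list (PrimrecRel.forall_mem_list primrecRel_mem)).comp
        (primrec_listRules.comp fst) (list_flatten.comp snd)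
    refine nat_omega_rec' _ (m := fun q => q.toSequent.weight)
      (l := fun q => (listRules q).flatten)
      (g := fun q rs => some (if ∃ ps ∈ listRules q, ∀ p ∈ ps, p ∈ rs.flatten then [q] else []))
      primrec_weight (list_flatten.comp primrec_listRules)
      (option_some.comp (Primrec.ite hex (primrec_singleton fst) (.const _))).to₂ ?_ ?_
    · intro q r hr
      obtain ⟨ps, hps, hr⟩ := List.mem_flatten.1 hr
      exact (isRule_toSequent.2 ⟨ps, hps, rfl⟩).weight_lt (List.mem_map_of_mem hr)
    · intro q
      have hmem (ps) (hps : ps ∈ listRules q) (p) (hp : p ∈ ps) :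
          p ∈ ((listRules q).flatten.map fun q => if RuleDerivable q then [q] else []).flatten ↔
            RuleDerivable p := by
        simp only [List.mem_flatten, List.mem_map]
        constructor
        · rintro ⟨_, ⟨r, -, rfl⟩, h⟩
          split_ifs at h with hr
          · rwa [List.mem_singleton.1 h]
          · simp at h
        · intro h
          exact ⟨_, ⟨p, ⟨ps, hps, hp⟩, rfl⟩, by simp [h]⟩
      congr 1
      refine if_congr ?_ rfl rfl
      rw [ruleDerivable_iff]
      exact exists_congr fun ps => and_congr_right fun hps =>
        forall₂_congr fun p hp => hmem ps hps p hp
  refine (PrimrecPred.not (Primrec.eq.comp hf (.const []))).of_eq fun q => ?_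
  split_ifs with h <;> simp [h]

theorem primrec_pow : Primrec₂ pow := by
  have h : Primrec₂ fun (A : Formula) (n : ℕ) =>
      (Nat.rec A (fun _ B => mul B A) n : Formula) :=
    nat_rec .id (primrec_mul.comp (snd.comp snd) fst).to₂
  refine (nat_casesOn (f := fun x : Formula × ℕ => x.2) snd (.const one)
    (h.comp (fst.comp fst) snd).to₂).of_eq fun x => ?_
  obtain ⟨A, n⟩ := x
  cases n with
  | zero => rfl
  | succ n =>
    induction n with
    | zero => rfl
    | succ n ih => exact congrArg (mul · A) ih

theorem primrec_powLe : Primrec₂ powLe := by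
  refine (nat_rec (g := fun A x => Formula.sup x.2 (pow A (x.1 + 1))) (.const one)
    (primrec_sup.comp (snd.comp snd)
      (primrec_pow.comp fst (succ.comp (fst.comp snd)))).to₂).of_eq fun A n => ?_
  induction n with
  | zero => rfl
  | succ n ih => exact congrArg (Formula.sup · _) ih

theorem primrec_approx :
    Primrec fun x : (ℕ × Bool) × Formula => x.2.approx x.1.1 x.1.2 := by
  let l (x : (ℕ × Bool) × Formula) : List ((ℕ × Bool) × Formula) :=
    x.2.elimCases (fun _ => []) [] [] (fun p => [((x.1.1, !x.1.2), p.1), (x.1, p.2)])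
      (fun p => [(x.1, p.1), (x.1, p.2)]) (fun p => [(x.1, p.1), (x.1, p.2)])
      (fun p => [(x.1, p.1), (x.1, p.2)]) (fun A => [(x.1, A)])
  -- `r` holds the values at the arguments listed by `l`, which are as many as are read here, so the
  -- default `zero` is never used.
  let g (x : (ℕ × Bool) × Formula) (r : List Formula) : Formula :=
    x.2.elimCases var zero one (fun _ => imp (r.getD 0 zero) (r.getD 1 zero))
      (fun _ => mul (r.getD 0 zero) (r.getD 1 zero))
      (fun _ => .sup (r.getD 0 zero) (r.getD 1 zero))
      (fun _ => .inf (r.getD 0 zero) (r.getD 1 zero))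
      (fun _ => if x.1.2 = true then .star (r.getD 0 zero) else powLe (r.getD 0 zero) x.1.1)
  have hl : Primrec l := by
    have h₀ : Primrec fun y : ((ℕ × Bool) × Formula) × Formula × Formula => y.1.1 :=
      fst.comp fst
    have h₁ : Primrec fun y : ((ℕ × Bool) × Formula) × Formula × Formula => y.2.1 :=
      fst.comp snd
    have h₂ : Primrec fun y : ((ℕ × Bool) × Formula) × Formula × Formula => y.2.2 :=
      snd.comp snd
    have h := (primrec_pair_list (h₀.pair h₁) (h₀.pair h₂)).to₂
    exact primrec_elimCases snd (Primrec₂.const _) (.const _) (.const _)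
      (primrec_pair_list (((fst.comp h₀).pair (Primrec.not.comp (snd.comp h₀))).pair h₁)
        (h₀.pair h₂)).to₂ h h h (primrec_singleton ((fst.comp fst).pair snd)).to₂
  have hg : Primrec₂ g := by
    have hr (k : ℕ) (β : Type) [Primcodable β] :
        Primrec fun y : (((ℕ × Bool) × Formula) × List Formula) × β => y.1.2.getD k zero :=
      (list_getD zero).comp (snd.comp fst) (.const k)
    refine Primrec₂.mk (primrec_elimCases (snd.comp fst) (primrec_var.comp snd).to₂ (.const _)
      (.const _) (primrec_imp.comp (hr 0 _) (hr 1 _)).to₂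
      (primrec_mul.comp (hr 0 _) (hr 1 _)).to₂ (primrec_sup.comp (hr 0 _) (hr 1 _)).to₂
      (primrec_inf.comp (hr 0 _) (hr 1 _)).to₂ (Primrec₂.mk ?_))
    exact Primrec.ite (Primrec.eq.comp (snd.comp (fst.comp (fst.comp fst))) (.const true))
      (primrec_star.comp (hr 0 _))
      (primrec_powLe.comp (hr 0 _) (fst.comp (fst.comp (fst.comp fst))))
  refine nat_omega_rec' _ (m := fun x => encode x.2) (l := l) (g := fun x r => some (g x r))
    (Primrec.encode.comp snd) hl (option_some.comp hg).to₂ ?_ ?_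
  · rintro ⟨nb, A⟩ x hx
    cases A <;>
      simp only [l, Formula.elimCases, List.mem_cons, List.not_mem_nil, or_false] at hx <;>
      rcases hx with rfl | rfl <;> simp only [Formula.encode_eq] <;>
      first
      | exact toNat_lt_star _
      | (rename_i A B; have := add_toNat_lt A B; omega)
  · rintro ⟨⟨n, b⟩, A⟩
    cases A with
    | star A => cases b <;> simp [l, g, Formula.elimCases, Formula.approx]
    | _ => simp [l, g, Formula.elimCases, Formula.approx]

/-! ### Decoding multisets, and decidability of the approximations -/

/-- The list of the partial sums of a list of natural numbers, in reverse order. -/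
def revRaise (l : List ℕ) : List ℕ :=
  (l.foldl (fun x m => ((m + x.2) :: x.1, m + x.2)) (([] : List ℕ), 0)).1

/-- A left fold produces the partial sums in reverse, which is immaterial in a multiset. The
induction generalizes the accumulator and the running sum. -/
theorem coe_revRaise (l : List ℕ) : (revRaise l : Multiset ℕ) = raise l 0 := by
  suffices ∀ (acc : List ℕ) (n : ℕ),
      ((l.foldl (fun x m => ((m + x.2) :: x.1, m + x.2)) (acc, n)).1 : Multiset ℕ) =
        acc + raise l n by simpa [revRaise] using this [] 0
  induction l with
  | nil => intro acc n; simp [raise]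
  | cons m l ih =>
    intro acc n
    rw [List.foldl_cons, ih, raise]
    simp only [← Multiset.cons_coe, Multiset.cons_add, Multiset.add_cons]

theorem primrec_revRaise : Primrec revRaise := by
  have hs : Primrec fun y : List ℕ × (List ℕ × ℕ) × ℕ => y.2.2 + y.2.1.2 :=
    nat_add.comp (snd.comp snd) (snd.comp (fst.comp snd))
  exact fst.comp (list_foldl .id (.const _)
    ((list_cons.comp hs (fst.comp (fst.comp snd))).pair hs).to₂)

/-- A computable enumeration of the elements of a multiset of formulae. -/
def toListOfCode (Γ : Multiset Formula) : List Formula :=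
  (revRaise (Denumerable.ofNat (List ℕ) (Denumerable.eqv _ Γ))).map (Denumerable.ofNat Formula)

/-- A multiset is coded by the list of successive differences of the sorted codes of its elements,
so partial sums recover these codes. -/
theorem coe_toListOfCode (Γ : Multiset Formula) : (toListOfCode Γ : Multiset Formula) = Γ := by
  rw [toListOfCode, ← Multiset.map_coe, coe_revRaise]
  have h (k : ℕ) : Denumerable.ofNat (Multiset Formula) k =
      (raise (Denumerable.ofNat (List ℕ) k) 0 : Multiset ℕ).map (Denumerable.ofNat Formula) :=
    Denumerable.ofNat_of_decode rfl
  rw [← h]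
  exact (Denumerable.eqv (Multiset Formula)).symm_apply_apply Γ

theorem primrec_toListOfCode : Primrec toListOfCode :=
  list_map (primrec_revRaise.comp ((Primrec.ofNat (List ℕ)).comp Primrec.encode))
    ((Primrec.ofNat Formula).comp snd).to₂

theorem computablePred_approx :
    ComputablePred fun x : Sequent × ℕ => (x.1.approx x.2).IsDerivable := by
  have h : Primrec fun x : Sequent × ℕ =>
      (((toListOfCode x.1.1).map fun A => A.approx x.2 false, x.1.2.approx x.2 true) :
        ListSequent) := by
    refine Primrec.pair (list_map (primrec_toListOfCode.comp (fst.comp fst)) (Primrec₂.mk ?_)) ?_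
    · exact primrec_approx.comp (((snd.comp fst).pair (.const false)).pair snd)
    · exact primrec_approx.comp ((snd.pair (.const true)).pair (snd.comp fst))
  refine ((primrecPred_ruleDerivable.comp h).of_eq fun x => ?_).computablePred
  have hx : ListSequent.toSequent
      ((toListOfCode x.1.1).map fun A => A.approx x.2 false, x.1.2.approx x.2 true) =
      x.1.approx x.2 := by
    rw [ListSequent.toSequent, Sequent.approx, ← Multiset.map_coe, coe_toListOfCode]
  rw [ruleDerivable_iff_isDerivable (hx ▸ x.1.noNegStar_approx x.2), hx]

end

end CommACT

theorem mainTheorem3 :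
    CommACT.IsPi01 CommACT.Sequent.IsDerivable ∧
    (∀ s : CommACT.Sequent, s.IsDerivable ↔ ∀ n : ℕ, (s.approx n).IsDerivable) ∧
    (∀ (s : CommACT.Sequent) (n : ℕ), (s.approx n).NoNegStar) ∧
    ComputablePred (fun x : CommACT.Sequent × ℕ => (x.1.approx x.2).IsDerivable) :=
  have h (s : CommACT.Sequent) : s.IsDerivable ↔ ∀ n : ℕ, (s.approx n).IsDerivable :=
    ⟨fun hs n => hs.approx n, CommACT.Sequent.isDerivable_of_approx⟩
  ⟨⟨_, CommACT.computablePred_approx, h⟩, h, CommACT.Sequent.noNegStar_approx,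
    CommACT.computablePred_approx⟩
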